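/- Fix an integer $K\ge 2$. An instance of ML-CAP-STEINER-TREE in digraphs consists of a finite simple digraph $G=(V,E)$, a root $r\in V$ from which every vertex of $G$ can be reached by a directed path, a set $T\subseteq V\setminus\{r\}$ of terminals, with $|T|\ge 2$, a length function $\ell:E\to\mathbb{Q}_{\ge 0}$ and a capacity function $c:E\to\mathbb{N}\setminus\{0\}$. A feasible solution is a subgraph $S$ of $G$ that is a directed tree rooted at $r$ (all arcs directed away from $r$), contains all vertices of $T$, and is such that for every arc $e=(u,v)$ of $S$ the subtree of $S$ rooted at $v$ contains at most $c(e)$ terminals (equivalently, at most $c(e)$ of the paths of $S$ from $r$ to the terminals contain $e$). The task is to find a feasible solution $S$ that minimizes $\sum_{e\in S}\ell(e)$, or to report that there is no feasible solution. Theorem. For every fixed integer $K\ge 2$, the problem ML-CAP-STEINER-TREE restricted to directed acyclic graphs $G$ and to exactly $|T|=K$ terminals is solvable in polynomial time: there are an algorithm (a random access machine program with logarithmic cost) and a polynomial $b$, both of which may depend on $K$, such that on every such instance the algorithm halts within time $b(N)$, where $N$ is the number of bits of the instance (all numbers being written in binary, rational lengths as a numerator and a denominator), and outputs the arc set of a minimum-length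 feasible solution if a feasible solution exists, and reports infeasibility otherwise. -/

import Mathlib

namespace CapSteiner

/-! ### Machine model: random access machine programs with logarithmic cost

A program manipulates finitely many natural number registers and finitely many arrays of natural
numbers (those that it mentions). Every operation is charged the bit length of the
numbers it handles, addresses included, so that polynomial time is the usual polynomial time. -/

/-- A machine state: register `x` holds `reg x`, cell `i` of array `a` holds `arr a i`. -/
structure State where
  reg : ℕ → ℕ
  arr : ℕ → ℕ → ℕ

/-- Arithmetic expressions. `get a e` reads the cell of array `a` whose index is the value of `e`;
subtraction is truncated and division is floor division (a quotient by zero is zero). -/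
inductive Expr where
  | lit (c : ℕ)
  | reg (x : ℕ)
  | get (a : ℕ) (e : Expr)
  | add (e₁ e₂ : Expr)
  | sub (e₁ e₂ : Expr)
  | mul (e₁ e₂ : Expr)
  | div (e₁ e₂ : Expr)

/-- The value of an expression. -/
def Expr.val (s : State) : Expr → ℕ
  | .lit c => c
  | .reg x => s.reg x
  | .get a e => s.arr a (e.val s)
  | .add e₁ e₂ => e₁.val s + e₂.val s
  | .sub e₁ e₂ => e₁.val s - e₂.val s
  | .mul e₁ e₂ => e₁.val s * e₂.val s
  | .div e₁ e₂ => e₁.val s / e₂.val s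

/-- The logarithmic cost of evaluating an expression: every subexpression is charged one plus the
bit length of its value. -/
def Expr.cost (s : State) : Expr → ℕ
  | .lit c => 1 + c.size
  | .reg x => 1 + (s.reg x).size
  | .get a e => e.cost s + (1 + (s.arr a (e.val s)).size)
  | .add e₁ e₂ => e₁.cost s + e₂.cost s + (1 + (e₁.val s + e₂.val s).size)
  | .sub e₁ e₂ => e₁.cost s + e₂.cost s + (1 + (e₁.val s - e₂.val s).size)
  | .mul e₁ e₂ => e₁.cost s + e₂.cost s + (1 + (e₁.val s * e₂.val s).size)
  | .div e₁ e₂ => e₁.cost s + e₂.cost s + (1 + (e₁.val s / e₂.val s).size)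

/-- Programs. `put a e₁ e₂` writes the value of `e₂` into the cell of array `a` whose index is the
value of `e₁`; a test succeeds when its value is nonzero. -/
inductive Prog where
  | skip
  | set (x : ℕ) (e : Expr)
  | put (a : ℕ) (e₁ e₂ : Expr)
  | seq (p q : Prog)
  | ite (e : Expr) (p q : Prog)
  | while (e : Expr) (p : Prog)

/-- The state after writing `v` into register `x`. -/
def State.setReg (s : State) (x v : ℕ) : State :=
  { s with reg := Function.update s.reg x v }

/-- The state after writing `v` into cell `i` of array `a`. -/
def State.setArr (s : State) (a i v : ℕ) : State :=
  { s with arr := Function.update s.arr a (Function.update (s.arr a) i v) }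

/-- `Exec p s s' t`: started in state `s`, program `p` halts in state `s'` at total cost `t`. -/
inductive Exec : Prog → State → State → ℕ → Prop
  | skip (s : State) : Exec .skip s s 1
  | set (x : ℕ) (e : Expr) (s : State) :
      Exec (.set x e) s (s.setReg x (e.val s)) (e.cost s + 1)
  | put (a : ℕ) (e₁ e₂ : Expr) (s : State) :
      Exec (.put a e₁ e₂) s (s.setArr a (e₁.val s) (e₂.val s)) (e₁.cost s + e₂.cost s + 1)
  | seq {p q : Prog} {s s' s'' : State} {t t' : ℕ} :
      Exec p s s' t → Exec q s' s'' t' → Exec (.seq p q) s s'' (t + t')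
  | iteTrue {e : Expr} {p q : Prog} {s s' : State} {t : ℕ} :
      e.val s ≠ 0 → Exec p s s' t → Exec (.ite e p q) s s' (e.cost s + 1 + t)
  | iteFalse {e : Expr} {p q : Prog} {s s' : State} {t : ℕ} :
      e.val s = 0 → Exec q s s' t → Exec (.ite e p q) s s' (e.cost s + 1 + t)
  | whileTrue {e : Expr} {p : Prog} {s s' s'' : State} {t t' : ℕ} :
      e.val s ≠ 0 → Exec p s s' t → Exec (.while e p) s' s'' t' →
        Exec (.while e p) s s'' (e.cost s + 1 + t + t')
  | whileFalse {e : Expr} {p : Prog} {s : State} :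
      e.val s = 0 → Exec (.while e p) s s (e.cost s + 1)

/-- Initial state on an input word `w` of natural numbers: `w` is stored in array `0`, its length
in register `0`, and everything else is zero. -/
def State.ofInput (w : List ℕ) : State where
  reg x := if x = 0 then w.length else 0
  arr a i := if a = 0 then w.getD i 0 else 0

/-- The output word is read from array `0`, its length from register `0`. -/
def State.output (s : State) : List ℕ := (List.range (s.reg 0)).map (s.arr 0)

/-- The number of bits (with one separator for each number) of a word of natural numbers. -/
def bitSize (w : List ℕ) : ℕ := (w.map fun x => x.size + 1).sum

/-- A problem with instances `X`, encoded as words by `enc`, and with `Correct x w` saying that the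
word `w` is a correct answer on `x`, is solvable in polynomial time on the instances in `D`. -/
def SolvableInPolyTime {X : Type} (enc : X → List ℕ) (D : X → Prop)
    (Correct : X → List ℕ → Prop) : Prop :=
  ∃ (p : Prog) (b : Polynomial ℕ), ∀ x : X, D x →
    ∃ (s : State) (t : ℕ), Exec p (State.ofInput (enc x)) s t ∧
      t ≤ b.eval (bitSize (enc x)) ∧ Correct x s.output

/-! ### The minimum-length capacitated Steiner tree problem in digraphs -/

/-- An arc of a digraph on `n` vertices, with its length and its capacity. -/
structure Arc (n : ℕ) where
  tail : Fin n
  head : Fin n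
  len : ℚ≥0
  cap : ℕ

/-- `v` can be reached from `u` by a directed path whose arcs all satisfy `A`. -/
def Reach {n : ℕ} (A : Arc n → Prop) : Fin n → Fin n → Prop :=
  Relation.ReflTransGen fun u v => ∃ a, A a ∧ a.tail = u ∧ a.head = v

/-- An instance: a digraph with vertices `Fin n`, given by the list of its arcs with their
lengths and capacities, a root from which all vertices can be reached, and
a list of at least two distinct terminals, none of which is the root. -/
structure Instance where
  n : ℕ
  arcs : List (Arc n)
  root : Fin n
  terms : List (Fin n)
  nodup_arcs : (arcs.map fun a => (a.tail, a.head)).Nodup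
  nodup_terms : terms.Nodup
  two_le_terms : 2 ≤ terms.length
  root_notMem : root ∉ terms
  cap_pos : ∀ a ∈ arcs, 0 < a.cap
  reach_root : ∀ v, Reach (· ∈ arcs) root v

namespace Instance

variable (I : Instance)

/-- The digraph has no directed cycle. -/
def IsDAG : Prop :=
  ∀ v, ¬ Relation.TransGen (fun u w => ∃ a ∈ I.arcs, a.tail = u ∧ a.head = w) v v

/-- The input word of an instance; a length is given by its numerator and its denominator. -/
def encode : List ℕ :=
  [I.n, I.arcs.length, I.root.val, I.terms.length] ++ I.terms.map Fin.val ++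
    I.arcs.flatMap fun a => [a.tail.val, a.head.val, a.len.num, a.len.den, a.cap]

/-- The arc set of a subgraph is given by the set `S` of the positions of its arcs in the list.
`I.ReachIn S u v`: the subgraph contains a directed path from `u` to `v`. -/
def ReachIn (S : Finset (Fin I.arcs.length)) : Fin I.n → Fin I.n → Prop :=
  Reach fun a => ∃ i ∈ S, I.arcs.get i = a

/-- `S` is a directed tree rooted at the root: no arc enters the root, no two arcs
enter the same vertex, and every arc can be reached from the root inside `S`. -/
structure IsTree (S : Finset (Fin I.arcs.length)) : Prop where
  head_ne_root : ∀ i ∈ S, (I.arcs.get i).head ≠ I.root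
  head_inj : ∀ i ∈ S, ∀ j ∈ S, (I.arcs.get i).head = (I.arcs.get j).head → i = j
  reach_tail : ∀ i ∈ S, I.ReachIn S I.root (I.arcs.get i).tail

/-- `S` is a directed tree rooted at the root that spans all terminals and such that, for every arc
`(u, v)` of `S`, the subtree of `S` rooted at `v` contains at most as many terminals as
the capacity of the arc. -/
structure IsFeasible (S : Finset (Fin I.arcs.length)) : Prop where
  isTree : I.IsTree S
  spans : ∀ t ∈ I.terms, I.ReachIn S I.root t
  capacity : ∀ i ∈ S,
    {t | t ∈ I.terms ∧ I.ReachIn S (I.arcs.get i).head t}.ncard ≤ (I.arcs.get i).cap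

/-- The total length of the arcs in `S`. -/
def length (S : Finset (Fin I.arcs.length)) : ℚ≥0 := ∑ i ∈ S, (I.arcs.get i).len

/-- `S` is a feasible solution of minimum length. -/
def IsOptimal (S : Finset (Fin I.arcs.length)) : Prop :=
  I.IsFeasible S ∧ ∀ S', I.IsFeasible S' → I.length S ≤ I.length S'

/-- Correct answers: the word `0` if there is no feasible solution, and otherwise `1` followed by
the characteristic vector of the arc set of an optimal solution. -/
def CorrectAnswer (w : List ℕ) : Prop :=
  ((∀ S, ¬ I.IsFeasible S) ∧ w = [0]) ∨
    ∃ S, I.IsOptimal S ∧ w = 1 :: List.ofFn fun i => if i ∈ S then 1 else 0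

end Instance

end CapSteiner

/-! Put one token on each terminal and let the tokens travel against the arcs. A move along an arc
`(u, v)` takes all tokens at `v` to `u`; it is allowed when `v` carries at least one and at most
`c(u, v)` tokens and no token has a higher level than `v`, where levels strictly increase along
arcs. Every move leaves an occupied vertex of maximum level for a lower one, so a vertex that has
been left is never entered again. Hence the arcs used form a forest with the tokens at its sources,
and the terminals below a new arc are those whose tokens cross it (`Traced.inv`).

When all tokens are at the root, this forest is a feasible solution (`Traced.isFeasible`).
Conversely, any feasible solution can be played from the terminals to the root by always moving from
a highest occupied vertex (`IsFeasible.exists_traced`); arcs leading to no terminal are dropped,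
which does not increase the length. The problem is therefore a shortest path problem on the `n ^ K`
position vectors. No arc is used twice, so Bellman-Ford with as many rounds as there are arcs solves
it (`Round`, `isOptimal_of_round`). As `n` is at most one more than the number of arcs (`n_le`),
this is polynomial for fixed `K`.

No predecessors are stored. The integer weight of an arc is its length times a common multiple of
the denominators, which leaves the low bits free, plus `2 ^ a` for the arc number `a`. Comparing
weights compares lengths first (`length_le_of_weight_le`), and the binary digits of the optimal
weight are the arc set (`weight_div_mod`).

For the running time, the algorithm is written in a language in which stored values and numbers of
rounds are cut down to two precomputed bounds. Polynomial time is then a structural fact about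
programs (`exists_polynomial_exec`), and the correctness proof shows that the cuts never alter a
value. -/

namespace CapSteiner

/-! ### Structured programs that run in polynomial time -/

/-- A syntactic bound for the growth of an expression. -/
def Expr.weight : Expr → ℕ
  | .lit c => c.size + 1
  | .reg _ => 1
  | .get _ e => e.weight + 1
  | .add e₁ e₂ => e₁.weight + e₂.weight + 1
  | .sub e₁ e₂ => e₁.weight + e₂.weight + 1
  | .mul e₁ e₂ => e₁.weight + e₂.weight + 1
  | .div e₁ e₂ => e₁.weight + e₂.weight + 1

/-- All numbers stored in `s` have at most `B` bits. -/
structure State.Bounded (B : ℕ) (s : State) : Prop where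
  one_le : 1 ≤ B
  reg : ∀ x, (s.reg x).size ≤ B
  arr : ∀ a i, (s.arr a i).size ≤ B

theorem size_add_le (a b : ℕ) : (a + b).size ≤ a.size + b.size + 1 := by
  rw [Nat.size_le]
  have h1 : a < 2 ^ a.size := Nat.lt_size_self a
  have h2 : b < 2 ^ b.size := Nat.lt_size_self b
  have h3 : 2 ^ a.size ≤ 2 ^ (a.size + b.size) := Nat.pow_le_pow_right (by norm_num) (by omega)
  have h4 : 2 ^ b.size ≤ 2 ^ (a.size + b.size) := Nat.pow_le_pow_right (by norm_num) (by omega)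
  rw [pow_succ]
  omega

theorem size_mul_le (a b : ℕ) : (a * b).size ≤ a.size + b.size := by
  rw [Nat.size_le, pow_add]
  exact Nat.mul_lt_mul'' (Nat.lt_size_self a) (Nat.lt_size_self b)

/-- Bit lengths add under multiplication, and under addition up to one carry bit, which the `+ 1` in
the weight of a node pays for because `1 ≤ B`. -/
theorem Expr.size_val_le {B : ℕ} {s : State} (h : s.Bounded B) (e : Expr) :
    (e.val s).size ≤ e.weight * B := by
  have hB := h.one_le
  induction e with
  | lit c => simp only [val, weight]; nlinarith
  | reg x => simpa [val, weight] using h.reg x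
  | get a e ih => simp only [val, weight]; nlinarith [h.arr a (e.val s)]
  | add e₁ e₂ h₁ h₂ =>
    have := size_add_le (e₁.val s) (e₂.val s)
    simp only [val, weight]; nlinarith
  | sub e₁ e₂ h₁ h₂ =>
    have := Nat.size_le_size (Nat.sub_le (e₁.val s) (e₂.val s))
    simp only [val, weight]; nlinarith
  | mul e₁ e₂ h₁ h₂ =>
    have := size_mul_le (e₁.val s) (e₂.val s)
    simp only [val, weight]; nlinarith
  | div e₁ e₂ h₁ h₂ =>
    have := Nat.size_le_size (Nat.div_le_self (e₁.val s) (e₂.val s))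
    simp only [val, weight]; nlinarith

theorem Expr.cost_le {B : ℕ} {s : State} (h : s.Bounded B) (e : Expr) :
    e.cost s ≤ e.weight * (1 + e.weight * B) := by
  have hB := h.one_le
  -- The map `w ↦ w * (1 + w * B)` is superadditive, with enough slack to pay for the node that
  -- joins two subexpressions.
  have key (w₁ w₂ : ℕ) : w₁ * (1 + w₁ * B) + w₂ * (1 + w₂ * B) + (1 + (w₁ + w₂ + 1) * B) ≤
      (w₁ + w₂ + 1) * (1 + (w₁ + w₂ + 1) * B) := by
    have : (w₁ + w₂ + 1) * (1 + (w₁ + w₂ + 1) * B) = w₁ * (1 + w₁ * B) + w₂ * (1 + w₂ * B) +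
      (1 + (w₁ + w₂ + 1) * B) + (2 * (w₁ * w₂) * B + w₁ * B + w₂ * B) := by ring
    omega
  induction e with
  | lit c =>
    have : (c.size + 1) * 1 ≤ (c.size + 1) * (1 + (c.size + 1) * B) := by gcongr; omega
    simp only [cost, weight]; omega
  | reg x => simp only [cost, weight]; linarith [h.reg x]
  | get a e ih =>
    have := key e.weight 0
    simp only [cost, weight] at *
    nlinarith [h.arr a (e.val s)]
  | add e₁ e₂ h₁ h₂ =>
    have := Expr.size_val_le h (.add e₁ e₂)
    simp only [cost, val, weight] at *; linarith [key e₁.weight e₂.weight]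
  | sub e₁ e₂ h₁ h₂ =>
    have := Expr.size_val_le h (.sub e₁ e₂)
    simp only [cost, val, weight] at *; linarith [key e₁.weight e₂.weight]
  | mul e₁ e₂ h₁ h₂ =>
    have := Expr.size_val_le h (.mul e₁ e₂)
    simp only [cost, val, weight] at *; linarith [key e₁.weight e₂.weight]
  | div e₁ e₂ h₁ h₂ =>
    have := Expr.size_val_le h (.div e₁ e₂)
    simp only [cost, val, weight] at *; linarith [key e₁.weight e₂.weight]

theorem State.Bounded.setReg {B : ℕ} {s : State} (h : s.Bounded B) (x : ℕ) {v : ℕ}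
    (hv : v.size ≤ B) : (s.setReg x v).Bounded B where
  one_le := h.one_le
  reg y := by
    by_cases hy : y = x
    · simpa [State.setReg, hy] using hv
    · simpa [State.setReg, hy] using h.reg y
  arr := h.arr

theorem State.Bounded.setArr {B : ℕ} {s : State} (h : s.Bounded B) (a i : ℕ) {v : ℕ}
    (hv : v.size ≤ B) : (s.setArr a i v).Bounded B where
  one_le := h.one_le
  reg := h.reg
  arr b j := by
    by_cases hb : b = a
    · by_cases hj : j = i
      · simpa [State.setArr, hb, hj] using hv
      · simpa [State.setArr, hb, hj] using h.arr a j
    · simpa [State.setArr, hb] using h.arr b j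

@[simp] theorem State.setReg_reg (s : State) (x v y : ℕ) :
    (s.setReg x v).reg y = if y = x then v else s.reg y := by
  simp [State.setReg, Function.update_apply]

@[simp] theorem State.setReg_arr (s : State) (x v : ℕ) : (s.setReg x v).arr = s.arr := rfl

@[simp] theorem State.setArr_reg (s : State) (a i v : ℕ) : (s.setArr a i v).reg = s.reg := rfl

theorem State.setArr_arr (s : State) (a i v b : ℕ) :
    (s.setArr a i v).arr b = if b = a then Function.update (s.arr a) i v else s.arr b := by
  simp [State.setArr, Function.update_apply]

@[simp] theorem State.setArr_arr_self (s : State) (a i v : ℕ) :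
    (s.setArr a i v).arr a = Function.update (s.arr a) i v := by
  simp [State.setArr]

/-! ### A language with bounded loops -/

/-- The expression `min e (reg x)`. -/
def Expr.cap (x : ℕ) (e : Expr) : Expr := .sub e (.sub e (.reg x))

@[simp] theorem Expr.val_cap (x : ℕ) (e : Expr) (s : State) :
    (e.cap x).val s = min (e.val s) (s.reg x) := by
  simp only [cap, val]; omega

/-- Programs with bounded loops. All values that are stored are cut down to the value of
register `1`, and the number of rounds of each loop is cut down to the value of register `2`.
In `loop x y e p`, the counter is `x`, and `y` stores the number of rounds. -/
inductive LoopProg where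
  | skip
  | set (x : ℕ) (e : Expr)
  | put (a : ℕ) (e₁ e₂ : Expr)
  | seq (p q : LoopProg)
  | ite (e : Expr) (p q : LoopProg)
  | loop (x y : ℕ) (e : Expr) (p : LoopProg)

namespace LoopProg

/-- The machine program of a program with bounded loops. -/
def compile : LoopProg → Prog
  | skip => .skip
  | set x e => .set x (e.cap 1)
  | put a e₁ e₂ => .put a e₁ (e₂.cap 1)
  | seq p q => .seq p.compile q.compile
  | ite e p q => .ite e p.compile q.compile
  | loop x y e p => .seq (.set y (e.cap 2)) (.seq (.set x (.lit 0))
      (.while (.sub (.reg y) (.reg x)) (.seq p.compile (.set x (.add (.reg x) (.lit 1))))))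

/-- The state transformation of a program with bounded loops. -/
def run : LoopProg → State → State
  | skip => id
  | set x e => fun s => s.setReg x (min (e.val s) (s.reg 1))
  | put a e₁ e₂ => fun s => s.setArr a (e₁.val s) (min (e₂.val s) (s.reg 1))
  | seq p q => fun s => q.run (p.run s)
  | ite e p q => fun s => if e.val s = 0 then q.run s else p.run s
  | loop x y e p => fun s =>
      (fun s => (p.run s).setReg x ((p.run s).reg x + 1))^[min (e.val s) (s.reg 2)]
        ((s.setReg y (min (e.val s) (s.reg 2))).setReg x 0)

/-- Whether the program may change register `z`. -/
def setsReg (z : ℕ) : LoopProg → Bool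
  | skip => false
  | set x _ => x == z
  | put _ _ _ => false
  | seq p q => p.setsReg z || q.setsReg z
  | ite _ p q => p.setsReg z || q.setsReg z
  | loop x y _ p => x == z || y == z || p.setsReg z

/-- Whether the program may change array `z`. -/
def setsArr (z : ℕ) : LoopProg → Bool
  | skip => false
  | set _ _ => false
  | put a _ _ => a == z
  | seq p q => p.setsArr z || q.setsArr z
  | ite _ p q => p.setsArr z || q.setsArr z
  | loop _ _ _ p => p.setsArr z

/-- Loop bodies do not change the counters of their loops, and registers `1` and `2` are
never changed. -/
def wf : LoopProg → Bool
  | skip => true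
  | set x _ => x != 1 && x != 2
  | put _ _ _ => true
  | seq p q => p.wf && q.wf
  | ite _ p q => p.wf && q.wf
  | loop x y _ p => x != y && x != 1 && x != 2 && y != 1 && y != 2 &&
      !p.setsReg x && !p.setsReg y && p.wf

/-- A bound for the running time, when all numbers have at most `B` bits and
loops have at most `L` rounds. -/
def time {R : Type} [CommSemiring R] (B L : R) : LoopProg → R
  | skip => 1
  | set _ e => (e.cap 1).weight * (1 + (e.cap 1).weight * B) + 1
  | put _ e₁ e₂ => e₁.weight * (1 + e₁.weight * B) +
      (e₂.cap 1).weight * (1 + (e₂.cap 1).weight * B) + 1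
  | seq p q => p.time B L + q.time B L
  | ite e p q => e.weight * (1 + e.weight * B) + 1 + (p.time B L + q.time B L)
  | loop _ _ e p => (e.cap 2).weight * (1 + (e.cap 2).weight * B) + 1 +
      (3 + ((L + 1) * (3 * (1 + 3 * B) + 1) + L * (p.time B L + (4 * (1 + 4 * B) + 1))))

/-- The time bound is a semiring expression, so the polynomial that witnesses polynomial time is the
same expression over `Polynomial ℕ`, and evaluation commutes with it. -/
theorem map_time {R R' : Type} [CommSemiring R] [CommSemiring R'] (φ : R →+* R') (B L : R)
    (p : LoopProg) : φ (p.time B L) = p.time (φ B) (φ L) := by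
  have h3 : φ 3 = 3 := map_ofNat φ 3
  have h4 : φ 4 = 4 := map_ofNat φ 4
  induction p <;> simp_all [time]

/-- A frame rule whose hypothesis is a Boolean computation, so that for concrete programs it is
discharged by `rfl`. -/
theorem run_reg {z : ℕ} {p : LoopProg} (h : p.setsReg z = false) (s : State) :
    (p.run s).reg z = s.reg z := by
  induction p generalizing s with
  | skip => rfl
  | set x e =>
    have h' : z ≠ x := by rintro rfl; simp [setsReg] at h
    simp [run, h']
  | put a e₁ e₂ => rfl
  | seq p q hp hq =>
    simp only [setsReg, Bool.or_eq_false_iff] at h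
    simp [run, hp h.1, hq h.2]
  | ite e p q hp hq =>
    simp only [setsReg, Bool.or_eq_false_iff] at h
    simp only [run]; split_ifs
    exacts [hq h.2 s, hp h.1 s]
  | loop x y e p hp =>
    simp only [setsReg, Bool.or_eq_false_iff, beq_eq_false_iff_ne] at h
    simp only [run]
    generalize min (e.val s) (s.reg 2) = k
    have key (j : ℕ) (s' : State) :
        ((fun s => (p.run s).setReg x ((p.run s).reg x + 1))^[j] s').reg z = s'.reg z := by
      induction j generalizing s' with
      | zero => rfl
      | succ j ih => rw [Function.iterate_succ_apply, ih]; simp [h.1.1.symm, hp h.2]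
    rw [key]; simp [h.1.1.symm, h.1.2.symm]

theorem run_arr {z : ℕ} {p : LoopProg} (h : p.setsArr z = false) (s : State) :
    (p.run s).arr z = s.arr z := by
  induction p generalizing s with
  | skip => rfl
  | set x e => rfl
  | put a e₁ e₂ =>
    have h' : z ≠ a := by rintro rfl; simp [setsArr] at h
    simp [run, State.setArr_arr, h']
  | seq p q hp hq =>
    simp only [setsArr, Bool.or_eq_false_iff] at h
    simp [run, hp h.1, hq h.2]
  | ite e p q hp hq =>
    simp only [setsArr, Bool.or_eq_false_iff] at h
    simp only [run]; split_ifs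
    exacts [hq h.2 s, hp h.1 s]
  | loop x y e p hp =>
    simp only [run]
    generalize min (e.val s) (s.reg 2) = k
    have key (j : ℕ) (s' : State) :
        ((fun s => (p.run s).setReg x ((p.run s).reg x + 1))^[j] s').arr z = s'.arr z := by
      induction j generalizing s' with
      | zero => rfl
      | succ j ih => rw [Function.iterate_succ_apply, ih]; simp [hp h]
    rw [key]; rfl

/-- The invariant rule for loops. -/
theorem run_loop {x y : ℕ} {e : Expr} {p : LoopProg} (hx : p.setsReg x = false) {s : State} {k : ℕ} (hk : e.val s = k) (hkL : k ≤ s.reg 2)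
    (Inv : ℕ → State → Prop) (h0 : Inv 0 ((s.setReg y k).setReg x 0))
    (hstep : ∀ i < k, ∀ s, s.reg x = i → Inv i s → Inv (i + 1) ((p.run s).setReg x (i + 1))) :
    Inv k ((loop x y e p).run s) := by
  simp only [run, hk, min_eq_left hkL]
  have key (i : ℕ) (hi : i ≤ k) :
      ((fun s => (p.run s).setReg x ((p.run s).reg x + 1))^[i]
        ((s.setReg y k).setReg x 0)).reg x = i ∧
      Inv i ((fun s => (p.run s).setReg x ((p.run s).reg x + 1))^[i]
        ((s.setReg y k).setReg x 0)) := by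
    induction i with
    | zero => exact ⟨by simp, h0⟩
    | succ i ih =>
      rw [Function.iterate_succ_apply']
      obtain ⟨h1, h2⟩ := ih (by omega)
      generalize ((fun s => (p.run s).setReg x ((p.run s).reg x + 1))^[i]
        ((s.setReg y k).setReg x 0)) = s' at h1 h2
      have h3 := run_reg hx s'
      have := hstep i (by omega) s' h1 h2
      simp only [h3, h1]
      exact ⟨by simp, this⟩
  exact (key k le_rfl).2

theorem setsReg_two {p : LoopProg} (hp : p.wf = true) : p.setsReg 2 = false := by
  induction p <;> simp_all [wf, setsReg]

/-- Each stored value is a minimum with a register that already fits into `B` bits, and register `2`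
is never changed. Boundedness and termination therefore follow by induction on the program alone,
whatever it computes. -/
theorem exists_exec {B L : ℕ} {p : LoopProg} (hp : p.wf = true) {s : State} (hs : s.Bounded B)
    (hL : s.reg 2 ≤ L) :
    (∃ t, Exec p.compile s (p.run s) t ∧ t ≤ p.time B L) ∧ (p.run s).Bounded B := by
  have size_min (s : State) (v x : ℕ) (hs : s.Bounded B) : (min v (s.reg x)).size ≤ B :=
    (Nat.size_le_size (min_le_right _ _)).trans (hs.reg x)
  induction p generalizing s with
  | skip => exact ⟨⟨1, .skip s, le_rfl⟩, hs⟩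
  | set x e =>
    refine ⟨⟨(e.cap 1).cost s + 1, ?_, ?_⟩, hs.setReg _ (size_min s (e.val s) 1 hs)⟩
    · have := Exec.set x (e.cap 1) s
      rwa [Expr.val_cap] at this
    · simpa [time] using Expr.cost_le hs (e.cap 1)
  | put a e₁ e₂ =>
    refine ⟨⟨e₁.cost s + (e₂.cap 1).cost s + 1, ?_, ?_⟩,
      hs.setArr _ _ (size_min s (e₂.val s) 1 hs)⟩
    · have := Exec.put a e₁ (e₂.cap 1) s
      rwa [Expr.val_cap] at this
    · simpa [time] using add_le_add (Expr.cost_le hs e₁) (Expr.cost_le hs (e₂.cap 1))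
  | seq p q ihp ihq =>
    simp only [wf, Bool.and_eq_true] at hp
    obtain ⟨⟨t, h1, h2⟩, h3⟩ := ihp hp.1 hs hL
    have hL' : (p.run s).reg 2 ≤ L := by
      rw [run_reg _ s]
      · exact hL
      · exact setsReg_two hp.1
    obtain ⟨⟨t', h1', h2'⟩, h3'⟩ := ihq hp.2 h3 hL'
    exact ⟨⟨_, .seq h1 h1', add_le_add h2 h2'⟩, h3'⟩
  | ite e p q ihp ihq =>
    simp only [wf, Bool.and_eq_true] at hp
    have hc := Expr.cost_le hs e
    simp only [run, compile, time, Nat.cast_id]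
    split_ifs with h
    · obtain ⟨⟨t, h1, h2⟩, h3⟩ := ihq hp.2 hs hL
      exact ⟨⟨_, .iteFalse h h1, by omega⟩, h3⟩
    · obtain ⟨⟨t, h1, h2⟩, h3⟩ := ihp hp.1 hs hL
      exact ⟨⟨_, .iteTrue h h1, by omega⟩, h3⟩
  | loop x y e p ih =>
    simp only [wf, Bool.and_eq_true, Bool.not_eq_true', bne_iff_ne] at hp
    obtain ⟨⟨⟨⟨⟨⟨⟨hxy, hx1⟩, hx2⟩, hy1⟩, hy2⟩, hpx⟩, hpy⟩, hwf⟩ := hp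
    have hp2 := setsReg_two hwf
    have hc := Expr.cost_le hs (e.cap 2)
    simp only [run, compile, time, Nat.cast_id]
    set k := min (e.val s) (s.reg 2) with hk
    have hkL : k ≤ L := (min_le_right _ _).trans hL
    have hkB : k.size ≤ B := size_min s _ 2 hs
    have hs1 : ((s.setReg y k).setReg x 0).Bounded B :=
      (hs.setReg y hkB).setReg x (by simp)
    set c := 3 * (1 + 3 * B) + 1
    set d := p.time B L + (4 * (1 + 4 * B) + 1)
    -- Induction on the number `j` of rounds that remain, since the `while` rule unfolds the first
    -- round.
    have key (j : ℕ) : ∀ s' : State, s'.Bounded B → s'.reg 2 ≤ L → s'.reg y = k → s'.reg x + j = k →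
        (∃ t, Exec (.while (.sub (.reg y) (.reg x))
            (.seq p.compile (.set x (.add (.reg x) (.lit 1))))) s'
          ((fun s => (p.run s).setReg x ((p.run s).reg x + 1))^[j] s') t ∧
          t ≤ (j + 1) * c + j * d) ∧
        ((fun s => (p.run s).setReg x ((p.run s).reg x + 1))^[j] s').Bounded B := by
      induction j with
      | zero =>
        intro s' hb _ h1 h2
        have hc' := Expr.cost_le hb (.sub (.reg y) (.reg x))
        simp only [Expr.weight] at hc'
        refine ⟨⟨_, .whileFalse (by simp [Expr.val]; omega), ?_⟩, hb⟩
        simp only [c]; omega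
      | succ j ihj =>
        intro s' hb h0 h1 h2
        have hc' := Expr.cost_le hb (.sub (.reg y) (.reg x))
        simp only [Expr.weight] at hc'
        obtain ⟨⟨t, e1, e2⟩, e3⟩ := ih hwf hb h0
        have hx := run_reg hpx s'
        have hc'' := Expr.cost_le e3 (.add (.reg x) (.lit 1))
        simp only [Expr.weight, Nat.size_one] at hc''
        -- The counter is incremented without a cut; it fits because it never exceeds the number `k`
        -- of rounds.
        have hb' : ((p.run s').setReg x ((p.run s').reg x + 1)).Bounded B := by
          refine e3.setReg x ((Nat.size_le_size ?_).trans hkB)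
          omega
        obtain ⟨⟨t', f1, f2⟩, f3⟩ := ihj _ hb' (by simp [hx2.symm, run_reg hp2, h0])
          (by simp [hxy.symm, run_reg hpy, h1]) (by simp [hx]; omega)
        rw [Function.iterate_succ_apply]
        refine ⟨⟨_, .whileTrue (by simp [Expr.val]; omega) (.seq e1 (.set _ _ _)) f1, ?_⟩, f3⟩
        have : (j + 1 + 1) * c + (j + 1) * d = (j + 1) * c + j * d + c + d := by ring
        simp only [c, d] at *
        omega
    obtain ⟨⟨t, h1, h2⟩, h3⟩ := key k _ hs1 (by simpa [hx2.symm, hy2.symm] using hL)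
      (by simp [hxy.symm]) (by simp)
    refine ⟨⟨_, .seq (.set _ _ _) (.seq (.set _ _ _) (t' := t) ?_), ?_⟩, h3⟩
    · simpa [Expr.val] using h1
    · have h4 : (k + 1) * c + k * d ≤ (L + 1) * c + L * d := by gcongr
      simp only [Expr.cost, Nat.size_zero]
      omega

end LoopProg
end CapSteiner

namespace CapSteiner

/-! ### Computing bounds for the numbers and the loops -/

/-- A multiple of all positive numbers in the word `w` that is also at least as large. -/
def bigProd (w : List ℕ) : ℕ := (w.map fun x => 2 * (x + (1 - x))).prod

/-- Subtraction is truncated, so `x + (1 - x)` is `max x 1` and zeros do not destroy the product.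
The separate power of two makes room for the bits that identify the arcs. -/
theorem bigProd_eq (w : List ℕ) :
    bigProd w = 2 ^ w.length * (w.map fun x => x + (1 - x)).prod := by
  induction w with
  | nil => rfl
  | cons x w ih =>
    simp only [bigProd, List.map_cons, List.prod_cons, List.length_cons, pow_succ] at *
    rw [ih]; ring

theorem bigProd_pos (w : List ℕ) : 0 < bigProd w := by
  refine Nat.pos_of_ne_zero fun h => ?_
  simp only [bigProd, List.prod_eq_zero_iff, List.mem_map] at h
  obtain ⟨x, -, hx⟩ := h
  omega

theorem two_pow_mul_dvd_bigProd {w : List ℕ} {x : ℕ} (hx : x ∈ w) (h0 : 0 < x) :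
    2 ^ w.length * x ∣ bigProd w := by
  rw [bigProd_eq]
  refine Nat.mul_dvd_mul_left _ (List.dvd_prod (List.mem_map.2 ⟨x, hx, ?_⟩))
  omega

theorem two_pow_length_le_bigProd (w : List ℕ) : 2 ^ w.length ≤ bigProd w :=
  Nat.le_of_dvd (bigProd_pos w) (by rw [bigProd_eq]; exact Nat.dvd_mul_right _ _)

theorem le_bigProd {w : List ℕ} {x : ℕ} (hx : x ∈ w) : x ≤ bigProd w := by
  rcases Nat.eq_zero_or_pos x with rfl | h
  · exact Nat.zero_le _
  · exact Nat.le_of_dvd (bigProd_pos w) ((Nat.dvd_mul_left _ _).trans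
      (two_pow_mul_dvd_bigProd hx h))

/-- A factor `2 * max x 1` is at most `2 ^ (x.size + 1)`, and `x.size + 1` is what `bitSize` charges
for `x`. So the product has a number of bits linear in the input size. -/
theorem bigProd_le (w : List ℕ) : bigProd w ≤ 2 ^ bitSize w := by
  induction w with
  | nil => rfl
  | cons x w ih =>
    simp only [bigProd, bitSize, List.map_cons, List.prod_cons, List.sum_cons] at *
    rw [pow_add, pow_succ]
    refine Nat.mul_le_mul ?_ ih
    have h1 : x < 2 ^ x.size := Nat.lt_size_self x
    have h2 : 0 < 2 ^ x.size := by positivity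
    omega

theorem bigProd_take_le (w : List ℕ) (i : ℕ) : bigProd (w.take i) ≤ bigProd w := by
  conv_rhs => rw [← List.take_append_drop i w]
  have h := bigProd_pos (w.drop i)
  simp only [bigProd, List.map_append, List.prod_append] at *
  exact Nat.le_mul_of_pos_right _ h

theorem bigProd_take_succ (w : List ℕ) {i : ℕ} (hi : i < w.length) :
    bigProd (w.take (i + 1)) = bigProd (w.take i) * (2 * (w.getD i 0 + (1 - w.getD i 0))) := by
  rw [List.take_add_one, List.getElem?_eq_getElem hi, List.getD_eq_getElem _ _ hi]
  simp only [bigProd, List.map_append, List.prod_append, Option.toList_some, List.map_cons,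
    List.map_nil, List.prod_singleton]

theorem length_le_bitSize (w : List ℕ) : w.length ≤ bitSize w := by
  induction w with
  | nil => simp
  | cons x w ih => simp only [bitSize, List.map_cons, List.sum_cons, List.length_cons] at *; omega

/-- The expression `e ^ k`. -/
def Expr.pow (e : Expr) : ℕ → Expr
  | 0 => .lit 1
  | k + 1 => .mul (e.pow k) e

theorem Expr.val_pow (e : Expr) (k : ℕ) (s : State) : (e.pow k).val s = e.val s ^ k := by
  induction k with
  | zero => rfl
  | succ k ih => simp [pow, val, ih, pow_succ]

/-- The factor by which `bigProd` grows at the position in register `3`. -/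
def preludeFactor : Expr :=
  .mul (.reg 4) (.mul (.lit 2) (.add (.get 0 (.reg 3)) (.sub (.lit 1) (.get 0 (.reg 3)))))

/-- The loop that computes `bigProd` in register `4`. -/
def preludeLoop : Prog :=
  .while (.sub (.reg 0) (.reg 3)) (.seq (.set 4 preludeFactor) (.set 3 (.add (.reg 3) (.lit 1))))

/-- The program that computes the bound for numbers and the bound for loops. -/
def prelude (K : ℕ) : Prog :=
  .seq (.set 4 (.lit 1)) (.seq preludeLoop
    (.seq (.set 1 (Expr.pow (.reg 4) (K + 6))) (.set 2 (Expr.pow (.reg 0) K))))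

/-- The state after `i` rounds of the loop of the prelude. -/
def preludeState (w : List ℕ) (i : ℕ) : State :=
  ((State.ofInput w).setReg 4 (bigProd (w.take i))).setReg 3 i

/-- The state after the prelude. -/
def prepared (K : ℕ) (w : List ℕ) : State :=
  ((preludeState w w.length).setReg 1 (bigProd w ^ (K + 6))).setReg 2 (w.length ^ K)

/-! ### Running time of the prelude -/

/-- A bound for the bit lengths of the numbers that are stored. -/
def maxBits {R : Type} [CommSemiring R] (K : ℕ) (N : R) : R := (K + 6) * (N + 1)

theorem size_pow_le {N k K a : ℕ} (ha : a ≤ 2 ^ N) (hk : k ≤ K + 6) :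
    (a ^ k).size ≤ maxBits K N := by
  rw [Nat.size_le]
  calc a ^ k ≤ (2 ^ N) ^ k := Nat.pow_le_pow_left ha k
    _ = 2 ^ (k * N) := by rw [← pow_mul, mul_comm]
    _ < 2 ^ maxBits K N := by
      refine Nat.pow_lt_pow_right (by norm_num) ?_
      simp only [maxBits, Nat.cast_id]
      nlinarith

theorem bounded_ofInput (K : ℕ) (w : List ℕ) :
    (State.ofInput w).Bounded (maxBits K (bitSize w)) := by
  have h1 : 1 ≤ maxBits K (bitSize w) := by simp only [maxBits, Nat.cast_id]; nlinarith
  refine ⟨h1, fun x => ?_, fun a i => ?_⟩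
  · simp only [State.ofInput]; split_ifs
    · have := size_pow_le (k := 1) (K := K)
        ((length_le_bitSize w).trans (Nat.lt_two_pow_self).le) (by omega)
      simpa using this
    · simp
  · simp only [State.ofInput]; split_ifs
    · by_cases hi : i < w.length
      · rw [List.getD_eq_getElem _ _ hi]
        have := size_pow_le (k := 1) (K := K)
          ((le_bigProd (List.getElem_mem hi)).trans (bigProd_le w)) (by omega)
        simpa using this
      · rw [List.getD_eq_default _ _ (not_lt.1 hi)]; simp
    · simp

theorem bounded_preludeState (K : ℕ) (w : List ℕ) {i : ℕ} (hi : i ≤ w.length) :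
    (preludeState w i).Bounded (maxBits K (bitSize w)) := by
  refine ((bounded_ofInput K w).setReg 4 ?_).setReg 3 ?_
  · simpa using size_pow_le (k := 1) (K := K)
      ((bigProd_take_le w i).trans (bigProd_le w)) (by omega)
  · simpa using size_pow_le (k := 1) (K := K)
      ((hi.trans (length_le_bitSize w)).trans (Nat.lt_two_pow_self).le) (by omega)

theorem bounded_prepared (K : ℕ) (w : List ℕ) :
    (prepared K w).Bounded (maxBits K (bitSize w)) :=
  ((bounded_preludeState K w le_rfl).setReg 1 (size_pow_le (bigProd_le w) le_rfl)).setReg 2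
    (size_pow_le ((length_le_bitSize w).trans (Nat.lt_two_pow_self).le) (by omega))

/-- A bound for the cost of an expression of weight `v`. -/
def costBound {R : Type} [CommSemiring R] (v : ℕ) (B : R) : R := v * (1 + v * B)

theorem Expr.cost_le_costBound {B : ℕ} {s : State} (h : s.Bounded B) (e : Expr) :
    e.cost s ≤ costBound e.weight B := by
  simpa [costBound] using Expr.cost_le h e

/-- This loop runs before the bounds in registers `1` and `2` exist, so its cost is estimated by
hand. Its intermediate values are `bigProd` of prefixes, which never exceed the final product. -/
theorem exists_exec_preludeLoop (K : ℕ) (w : List ℕ) :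
    ∃ t, Exec preludeLoop (preludeState w 0) (preludeState w w.length) t ∧
      t ≤ (bitSize w + 1) * (costBound 3 (maxBits K (bitSize w)) +
        costBound preludeFactor.weight (maxBits K (bitSize w)) +
        costBound 4 (maxBits K (bitSize w)) + 3) := by
  set B := maxBits K (bitSize w)
  set c := costBound 3 B + costBound preludeFactor.weight B + costBound 4 B + 3
  have key (j : ℕ) : ∀ i, i + j = w.length →
      ∃ t, Exec preludeLoop (preludeState w i) (preludeState w w.length) t ∧ t ≤ (j + 1) * c := by
    induction j with
    | zero =>
      intro i hi
      obtain rfl : i = w.length := hi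
      refine ⟨_, .whileFalse (by simp [Expr.val, preludeState, State.ofInput]), ?_⟩
      have h1 := Expr.cost_le (bounded_preludeState K w le_rfl) (.sub (.reg 0) (.reg 3))
      simp only [Expr.weight] at h1
      simp only [c, costBound, Nat.cast_id, Nat.cast_ofNat]
      omega
    | succ j ih =>
      intro i hi
      obtain ⟨t, h1, h2⟩ := ih (i + 1) (by omega)
      have hb := bounded_preludeState K w (i := i) (by omega)
      have e1 := Exec.set 4 preludeFactor (preludeState w i)
      have hb' : ((preludeState w i).setReg 4
          (preludeFactor.val (preludeState w i))).Bounded B := by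
        refine hb.setReg 4 ?_
        have := (bounded_preludeState K w (i := i + 1) (by omega)).reg 4
        simpa [preludeState, State.ofInput, preludeFactor, Expr.val,
          bigProd_take_succ w (show i < w.length by omega)] using this
      have e2 := Exec.set 3 (.add (.reg 3) (.lit 1))
        ((preludeState w i).setReg 4 (preludeFactor.val (preludeState w i)))
      have hs : ((preludeState w i).setReg 4 (preludeFactor.val (preludeState w i))).setReg 3
          (Expr.val ((preludeState w i).setReg 4 (preludeFactor.val (preludeState w i)))
            (.add (.reg 3) (.lit 1))) = preludeState w (i + 1) := by
        have hr := bigProd_take_succ w (show i < w.length by omega)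
        simp only [preludeState, hr, State.setReg, preludeFactor, Expr.val, State.ofInput,
          State.mk.injEq, and_true]
        funext x
        by_cases h3 : x = 3
        · simp [h3]
        · by_cases h4 : x = 4 <;> simp [h3, h4]
      rw [hs] at e2
      refine ⟨_, .whileTrue ?_ (.seq e1 e2) h1, ?_⟩
      · simp [Expr.val, preludeState, State.ofInput]; omega
      · have c1 : _ ≤ costBound 3 B := Expr.cost_le_costBound hb (.sub (.reg 0) (.reg 3))
        have c2 : _ ≤ costBound _ B := Expr.cost_le_costBound hb preludeFactor
        have c3 : _ ≤ costBound 4 B := Expr.cost_le_costBound hb' (.add (.reg 3) (.lit 1))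
        have : (j + 1 + 1) * c = (j + 1) * c + c := by ring
        rw [this]
        omega
  obtain ⟨t, h1, h2⟩ := key w.length 0 (by simp)
  exact ⟨t, h1, h2.trans (Nat.mul_le_mul_right _ (by have := length_le_bitSize w; omega))⟩

/-- A bound for the running time of the prelude. -/
def preludeTime {R : Type} [CommSemiring R] (K : ℕ) (N : R) : R :=
  3 + ((N + 1) * (costBound 3 (maxBits K N) + costBound preludeFactor.weight (maxBits K N) +
    costBound 4 (maxBits K N) + 3) +
  (costBound (Expr.pow (.reg 4) (K + 6)).weight (maxBits K N) + 1 +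
    (costBound (Expr.pow (.reg 0) K).weight (maxBits K N) + 1)))

theorem exists_exec_prelude (K : ℕ) (w : List ℕ) :
    ∃ t, Exec (prelude K) (State.ofInput w) (prepared K w) t ∧ t ≤ preludeTime K (bitSize w) := by
  obtain ⟨t, h1, h2⟩ := exists_exec_preludeLoop K w
  have h0 : (State.ofInput w).setReg 4 ((Expr.lit 1).val (State.ofInput w)) =
      preludeState w 0 := by
    simp only [preludeState, State.setReg, Expr.val, State.ofInput, State.mk.injEq, and_true]
    funext x
    by_cases h3 : x = 3
    · simp [h3]
    · by_cases h4 : x = 4 <;> simp [h3, h4, bigProd]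
  have e1 := Exec.set 4 (.lit 1) (State.ofInput w)
  rw [h0] at e1
  have hb := bounded_preludeState K w le_rfl
  have e2 := Exec.set 1 (Expr.pow (.reg 4) (K + 6)) (preludeState w w.length)
  have hv : (Expr.pow (.reg 4) (K + 6)).val (preludeState w w.length) = bigProd w ^ (K + 6) := by
    simp [Expr.val_pow, Expr.val, preludeState]
  rw [hv] at e2
  have e3 := Exec.set 2 (Expr.pow (.reg 0) K)
    ((preludeState w w.length).setReg 1 (bigProd w ^ (K + 6)))
  have hv' : (Expr.pow (.reg 0) K).val
      ((preludeState w w.length).setReg 1 (bigProd w ^ (K + 6))) = w.length ^ K := by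
    simp [Expr.val_pow, Expr.val, preludeState, State.ofInput]
  rw [hv'] at e3
  refine ⟨_, .seq e1 (.seq h1 (.seq e2 e3)), ?_⟩
  have c2 := Expr.cost_le hb (Expr.pow (.reg 4) (K + 6))
  have c3 := Expr.cost_le (hb.setReg 1 (size_pow_le (K := K) (bigProd_le w) le_rfl))
    (Expr.pow (.reg 0) K)
  simp only [Expr.cost, Nat.size_one, preludeTime, costBound, Nat.cast_id] at *
  omega

/-- After the prelude, programs with bounded loops run in polynomial time. -/
theorem exists_polynomial_exec (K : ℕ) {p : LoopProg} (hp : p.wf = true) :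
    ∃ b : Polynomial ℕ, ∀ w : List ℕ, ∃ t,
      Exec (.seq (prelude K) p.compile) (State.ofInput w) (p.run (prepared K w)) t ∧
        t ≤ b.eval (bitSize w) := by
  refine ⟨preludeTime K Polynomial.X + p.time (maxBits K Polynomial.X) (Polynomial.X ^ K),
    fun w => ?_⟩
  obtain ⟨t, h1, h2⟩ := exists_exec_prelude K w
  obtain ⟨⟨t', h1', h2'⟩, -⟩ := LoopProg.exists_exec hp (bounded_prepared K w)
    (L := bitSize w ^ K) (by
      simpa [prepared] using Nat.pow_le_pow_left (length_le_bitSize w) K)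
  refine ⟨_, .seq h1 h1', ?_⟩
  have e := LoopProg.map_time (Polynomial.evalRingHom (bitSize w))
    (maxBits K Polynomial.X) (Polynomial.X ^ K) p
  have hm : Polynomial.eval (bitSize w) (maxBits K Polynomial.X) = maxBits K (bitSize w) := by
    simp [maxBits]
  simp only [Polynomial.coe_evalRingHom, hm, Polynomial.eval_pow, Polynomial.eval_X] at e
  have e' : Polynomial.eval (bitSize w) (preludeTime K Polynomial.X) =
      preludeTime K (bitSize w) := by
    simp [preludeTime, costBound, hm]
  rw [Polynomial.eval_add, e, e']
  exact add_le_add h2 h2'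

end CapSteiner

namespace CapSteiner
namespace Instance

/-! ### Moving tokens against the arcs of an acyclic digraph -/

variable {I : Instance}

theorem reachIn_mono {S S' : Finset (Fin I.arcs.length)} (h : S ⊆ S') {u v : Fin I.n}
    (huv : I.ReachIn S u v) : I.ReachIn S' u v :=
  Relation.ReflTransGen.mono
    (fun _ _ ⟨a, ⟨i, hi, hia⟩, h1⟩ => ⟨a, ⟨i, h hi, hia⟩, h1⟩) _ _ huv

theorem reachIn_cases_tail {S : Finset (Fin I.arcs.length)} {u v : Fin I.n}
    (h : I.ReachIn S u v) :
    u = v ∨ ∃ i ∈ S, (I.arcs.get i).head = v ∧ I.ReachIn S u (I.arcs.get i).tail := by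
  rcases Relation.ReflTransGen.cases_tail h with h | ⟨w, h3, ⟨a, ⟨i, hi, rfl⟩, h1, h2⟩⟩
  · exact .inl h.symm
  · exact .inr ⟨i, hi, h2, h1 ▸ h3⟩

theorem reachIn_arc {S : Finset (Fin I.arcs.length)} {i : Fin I.arcs.length} (hi : i ∈ S) :
    I.ReachIn S (I.arcs.get i).tail (I.arcs.get i).head :=
  .single ⟨_, ⟨i, hi, rfl⟩, rfl, rfl⟩

variable (I) in
/-- The level strictly increases along every arc. -/
def IsLevel (lev : Fin I.n → ℕ) : Prop :=
  ∀ i : Fin I.arcs.length, lev (I.arcs.get i).tail < lev (I.arcs.get i).head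

theorem IsLevel.lt_of_reachIn {lev : Fin I.n → ℕ} (hlev : I.IsLevel lev)
    {S : Finset (Fin I.arcs.length)} {u v : Fin I.n} (h : I.ReachIn S u v) :
    u = v ∨ lev u < lev v := by
  induction h with
  | refl => exact .inl rfl
  | tail _ h ih =>
    obtain ⟨a, ⟨i, hi, rfl⟩, rfl, rfl⟩ := h
    have := hlev i
    rcases ih with rfl | ih
    · exact .inr this
    · exact .inr (ih.trans this)

theorem IsLevel.le_of_reachIn {lev : Fin I.n → ℕ} (hlev : I.IsLevel lev)
    {S : Finset (Fin I.arcs.length)} {u v : Fin I.n} (h : I.ReachIn S u v) : lev u ≤ lev v := by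
  rcases hlev.lt_of_reachIn h with rfl | h
  exacts [le_rfl, h.le]

variable (I) in
/-- All tokens at the head of the arc `i` may be moved to its tail. -/
def Movable (lev : Fin I.n → ℕ) (f : Fin I.terms.length → Fin I.n)
    (i : Fin I.arcs.length) : Prop :=
  (∃ j, f j = (I.arcs.get i).head) ∧ (∀ j, lev (f j) ≤ lev (I.arcs.get i).head) ∧
    (Finset.univ.filter fun j => f j = (I.arcs.get i).head).card ≤ (I.arcs.get i).cap

variable (I) in
/-- The positions of the tokens after a move. -/
def move (f : Fin I.terms.length → Fin I.n) (i : Fin I.arcs.length) :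
    Fin I.terms.length → Fin I.n :=
  fun j => if f j = (I.arcs.get i).head then (I.arcs.get i).tail else f j

variable (I) in
/-- Starting at the terminals, the tokens can get to the positions `f`, with moves along the
arcs in `S`. -/
inductive Traced (lev : Fin I.n → ℕ) :
    (Fin I.terms.length → Fin I.n) → Finset (Fin I.arcs.length) → Prop
  | start : Traced lev I.terms.get ∅
  | step {f S i} : Traced lev f S → I.Movable lev f i → Traced lev (I.move f i) (insert i S)

/-- The properties of traced positions and arc sets. -/
structure TracedInv (lev : Fin I.n → ℕ) (f : Fin I.terms.length → Fin I.n)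
    (S : Finset (Fin I.arcs.length)) : Prop where
  reach_term : ∀ j, I.ReachIn S (f j) (I.terms.get j)
  level_le : ∀ i ∈ S, ∀ j, lev (f j) ≤ lev (I.arcs.get i).head
  ne_head : ∀ i ∈ S, ∀ j, f j ≠ (I.arcs.get i).head
  head_inj : ∀ i ∈ S, ∀ j ∈ S, (I.arcs.get i).head = (I.arcs.get j).head → i = j
  reach_tail : ∀ i ∈ S, ∃ j, I.ReachIn S (f j) (I.arcs.get i).tail
  capacity : ∀ i ∈ S, {j | I.ReachIn S (I.arcs.get i).head (I.terms.get j)}.ncard ≤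
    (I.arcs.get i).cap

theorem TracedInv.notMem {lev : Fin I.n → ℕ} {f : Fin I.terms.length → Fin I.n}
    {S : Finset (Fin I.arcs.length)} {i : Fin I.arcs.length} (h : TracedInv lev f S)
    (hm : I.Movable lev f i) : i ∉ S := by
  obtain ⟨j, hj⟩ := hm.1
  exact fun hi => h.ne_head i hi j hj

/-- Tokens stand at vertices without incoming arcs of `S`, and every vertex has at most one incoming
arc. Going backwards from a terminal thus leads to a single possible token position. -/
theorem TracedInv.eq_of_reachIn {lev : Fin I.n → ℕ} {f : Fin I.terms.length → Fin I.n}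
    {S : Finset (Fin I.arcs.length)} (h : TracedInv lev f S) {j j' : Fin I.terms.length}
    (hr : I.ReachIn S (f j) (I.terms.get j')) : f j = f j' := by
  -- Stated for two paths with a common end `w`, so that the induction can strip the last arc from
  -- both at once.
  have root (v w : Fin I.n) (hv : I.ReachIn S v w) (j j') (hw : I.ReachIn S (f j) w)
      (hvj : v = f j') : f j = f j' := by
    induction hw with
    | refl =>
      rcases reachIn_cases_tail hv with rfl | ⟨i, hi, h1, -⟩
      · exact hvj
      · exact (h.ne_head i hi j h1.symm).elim
    | tail _ hlast ih =>
      obtain ⟨a, ⟨i, hi, rfl⟩, rfl, rfl⟩ := hlast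
      rcases reachIn_cases_tail hv with rfl | ⟨i', hi', h1, h2⟩
      · exact (h.ne_head i hi j' hvj.symm).elim
      · obtain rfl := h.head_inj i' hi' i hi h1
        exact ih h2
  exact root _ _ (h.reach_term j') j j' hr rfl

/-- A path through the new arc would visit its tail, but levels do not decrease along a path and `u`
already lies above that tail. -/
theorem reachIn_insert {lev : Fin I.n → ℕ} (hlev : I.IsLevel lev)
    {S : Finset (Fin I.arcs.length)} {i : Fin I.arcs.length} {u v : Fin I.n}
    (hu : lev (I.arcs.get i).tail < lev u) (h : I.ReachIn (insert i S) u v) :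
    I.ReachIn S u v := by
  induction h with
  | refl => exact .refl
  | tail h1 h2 ih =>
    obtain ⟨a, ⟨i', hi', rfl⟩, rfl, rfl⟩ := h2
    rcases Finset.mem_insert.1 hi' with rfl | hi'
    · exact absurd (hlev.le_of_reachIn h1) (by omega)
    · exact ih.trans (reachIn_arc hi')

/-- Moves start at a token of maximum level. Hence all earlier heads lie at least as high as every
token, and the new tail lies strictly below them; this keeps the heads distinct and the subtrees
below earlier arcs unchanged. -/
theorem Traced.inv {lev : Fin I.n → ℕ} (hlev : I.IsLevel lev)
    {f : Fin I.terms.length → Fin I.n} {S : Finset (Fin I.arcs.length)}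
    (h : I.Traced lev f S) : TracedInv lev f S := by
  induction h with
  | start => exact ⟨fun j => .refl, by simp, by simp, by simp, by simp, by simp⟩
  | @step f S i _ hm ih =>
    obtain ⟨⟨j₀, hj₀⟩, hmax, hcap⟩ := hm
    have hi := hlev i
    have hsub : S ⊆ insert i S := Finset.subset_insert i S
    have hmove (j) : I.ReachIn (insert i S) (I.move f i j) (f j) := by
      simp only [move]; split_ifs with h
      · rw [h]; exact reachIn_arc (Finset.mem_insert_self i S)
      · exact .refl
    have hle (j) : lev (I.move f i j) ≤ lev (f j) := hlev.le_of_reachIn (hmove j)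
    refine ⟨fun j => (hmove j).trans (reachIn_mono hsub (ih.reach_term j)), ?_, ?_, ?_, ?_, ?_⟩
    · intro i' hi' j
      rcases Finset.mem_insert.1 hi' with rfl | hi'
      · exact (hle j).trans (hmax j)
      · exact (hle j).trans (ih.level_le i' hi' j)
    · intro i' hi' j
      rcases Finset.mem_insert.1 hi' with rfl | hi'
      · simp only [move]; split_ifs with h
        · intro h; rw [← h] at hi; exact hi.false
        · exact h
      · simp only [move]; split_ifs with h
        · intro h
          -- The new tail is strictly below the token `j₀`, which is not above the earlier head, so
          -- no token re-enters that head.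
          have := ih.level_le i' hi' j₀
          rw [hj₀, ← h] at this
          omega
        · exact ih.ne_head i' hi' j
    · intro i₁ h₁ i₂ h₂ he
      rcases Finset.mem_insert.1 h₁ with h₁ | h₁ <;>
        rcases Finset.mem_insert.1 h₂ with h₂ | h₂
      · exact h₁.trans h₂.symm
      · exact (ih.ne_head i₂ h₂ j₀ (hj₀.trans (h₁ ▸ he))).elim
      · exact (ih.ne_head i₁ h₁ j₀ (hj₀.trans (h₂ ▸ he.symm))).elim
      · exact ih.head_inj i₁ h₁ i₂ h₂ he
    · intro i' hi'
      rcases Finset.mem_insert.1 hi' with rfl | hi'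
      · exact ⟨j₀, by simp only [move, hj₀, if_true]; exact .refl⟩
      · obtain ⟨j, hj⟩ := ih.reach_tail i' hi'
        exact ⟨j, (hmove j).trans (reachIn_mono hsub hj)⟩
    · intro i' hi'
      rcases Finset.mem_insert.1 hi' with rfl | hi'
      · refine le_trans ?_ hcap
        rw [← Set.ncard_coe_finset]
        refine Set.ncard_le_ncard (fun j hj => ?_) (Set.toFinite _)
        -- A terminal below the new arc was already reachable from its head, where the token `j₀`
        -- stands; by uniqueness of the source its own token stands there too and was counted in the
        -- move.
        have hj' := reachIn_insert hlev hi hj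
        rw [← hj₀] at hj'
        simpa [hj₀] using (ih.eq_of_reachIn hj').symm
      · refine le_trans (Set.ncard_le_ncard (fun j hj => ?_) (Set.toFinite _)) (ih.capacity i' hi')
        refine reachIn_insert hlev ?_ hj
        have := ih.level_le i' hi' j₀
        rw [hj₀] at this
        omega

/-- With every token at the root, the invariants of traced arc sets turn into the conditions of
feasibility. -/
theorem Traced.isFeasible {lev : Fin I.n → ℕ} (hlev : I.IsLevel lev)
    {S : Finset (Fin I.arcs.length)} (h : I.Traced lev (fun _ => I.root) S) :
    I.IsFeasible S := by
  have inv := h.inv hlev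
  have hpos : 0 < I.terms.length := by have := I.two_le_terms; omega
  refine ⟨⟨fun i hi => (inv.ne_head i hi ⟨0, hpos⟩).symm, inv.head_inj, fun i hi => ?_⟩, ?_, ?_⟩
  · obtain ⟨_, hj⟩ := inv.reach_tail i hi
    exact hj
  · intro t ht
    obtain ⟨j, rfl⟩ := List.get_of_mem ht
    exact inv.reach_term j
  · intro i hi
    refine le_trans ?_ (inv.capacity i hi)
    have : {t | t ∈ I.terms ∧ I.ReachIn S (I.arcs.get i).head t} ⊆
        I.terms.get '' {j | I.ReachIn S (I.arcs.get i).head (I.terms.get j)} := by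
      rintro t ⟨ht, hr⟩
      obtain ⟨j, rfl⟩ := List.get_of_mem ht
      exact ⟨j, hr, rfl⟩
    exact (Set.ncard_le_ncard this (Set.toFinite _)).trans (Set.ncard_image_le (Set.toFinite _))

/-- Take a token of maximum level and move along the arc of `S` that enters its vertex. The sum of
the levels drops with each move. Only a subset of `S` arises, because arcs that lead to no terminal
are never used. -/
theorem IsFeasible.exists_traced {lev : Fin I.n → ℕ} (hlev : I.IsLevel lev)
    {S : Finset (Fin I.arcs.length)} (h : I.IsFeasible S) :
    ∃ S' ⊆ S, I.Traced lev (fun _ => I.root) S' := by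
  have key (k : ℕ) : ∀ f S', I.Traced lev f S' → S' ⊆ S → (∀ j, I.ReachIn S I.root (f j)) →
      (∀ j, I.ReachIn S (f j) (I.terms.get j)) → ∑ j, lev (f j) = k →
      ∃ S' ⊆ S, I.Traced lev (fun _ => I.root) S' := by
    induction k using Nat.strong_induction_on with
    | _ k ih =>
    intro f S' hf hS' hroot hterm hk
    by_cases hall : ∀ j, f j = I.root
    · obtain rfl : f = fun _ => I.root := funext hall
      exact ⟨S', hS', hf⟩
    · have hne : Nonempty (Fin I.terms.length) := (not_forall.1 hall).nonempty
      obtain ⟨j₀, hj₀⟩ := Finite.exists_max fun j => lev (f j)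
      -- All tokens are reachable from the root, hence not below it; if a highest one were at the
      -- root, all would be.
      have hj₀r : I.root ≠ f j₀ := by
        intro he
        refine hall fun j => ?_
        rcases hlev.lt_of_reachIn (hroot j) with h | h
        · exact h.symm
        · have := hj₀ j
          rw [← he] at this
          omega
      obtain he | ⟨i, hi, hhead, hr⟩ := reachIn_cases_tail (hroot j₀)
      · exact (hj₀r he).elim
      -- Tokens at the head belong to distinct terminals in the subtree of `S` below the arc, so the
      -- capacity condition of `S` bounds their number.
      have hmv : I.Movable lev f i := by
        refine ⟨⟨j₀, hhead.symm⟩, fun j => hhead ▸ hj₀ j, le_trans ?_ (h.capacity i hi)⟩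
        rw [← Set.ncard_coe_finset]
        refine Set.ncard_le_ncard_of_injOn I.terms.get (fun j hj => ?_) ?_ ?_
        · refine ⟨List.get_mem _ _, ?_⟩
          have : f j = (I.arcs.get i).head := by simpa using hj
          rw [← this]
          exact hterm j
        · exact (List.nodup_iff_injective_get.1 I.nodup_terms).injOn
        · exact (List.finite_toSet I.terms).subset fun t ht => ht.1
      have hle (j) : I.ReachIn S (I.move f i j) (f j) := by
        simp only [move]; split_ifs with h
        · rw [h]; exact reachIn_arc hi
        · exact .refl
      refine ih _ ?_ _ _ (hf.step hmv) (Finset.insert_subset hi hS') ?_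
        (fun j => (hle j).trans (hterm j)) rfl
      · rw [← hk]
        refine Finset.sum_lt_sum (fun j _ => hlev.le_of_reachIn (hle j)) ⟨j₀, Finset.mem_univ _, ?_⟩
        simp only [move, if_pos hhead.symm]
        exact (hlev i).trans_eq (congrArg lev hhead)
      · intro j
        simp only [move]; split_ifs
        · exact hr
        · exact hroot j
  exact key _ _ _ .start (Finset.empty_subset S)
    (fun j => h.spans _ (List.get_mem _ _)) (fun j => .refl) rfl

end Instance
end CapSteiner

namespace CapSteiner
namespace Instance

/-! ### The input word, codes of token positions, and integer weights -/

variable (I : Instance)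

theorem getD_flatMap {α : Type} (l : List α) (f : α → List ℕ) (k : ℕ)
    (hf : ∀ a, (f a).length = k) {a : ℕ} (ha : a < l.length) {i : ℕ} (hi : i < k) :
    (l.flatMap f).getD (k * a + i) 0 = (f l[a]).getD i 0 := by
  induction l generalizing a with
  | nil => simp at ha
  | cons b l ih =>
    rw [List.flatMap_cons]
    cases a with
    | zero => rw [List.getD_append _ _ _ _ (by rw [hf]; omega)]; simp
    | succ a =>
      have h : k * (a + 1) + i = k * a + i + k := by ring
      rw [List.getD_append_right _ _ _ _ (by rw [hf]; omega), hf, h, Nat.add_sub_cancel,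
        ih (by simpa using ha)]
      rfl

theorem length_encode : I.encode.length = 4 + I.terms.length + 5 * I.arcs.length := by
  have : (I.arcs.flatMap fun a => [a.tail.val, a.head.val, a.len.num, a.len.den, a.cap]).length =
      5 * I.arcs.length := by
    rw [List.length_flatMap]; simp [mul_comm]
  simp [encode, this]
  omega

theorem encode_term (j : Fin I.terms.length) : I.encode.getD (4 + j) 0 = I.terms.get j := by
  unfold encode
  rw [List.getD_append _ _ _ _ (by simp; omega), List.getD_append_right _ _ _ _ (by simp)]
  simp

theorem encode_arc (a : Fin I.arcs.length) {i : ℕ} (hi : i < 5) :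
    I.encode.getD (4 + I.terms.length + i + 5 * a) 0 =
      [(I.arcs.get a).tail.val, (I.arcs.get a).head.val, (I.arcs.get a).len.num,
        (I.arcs.get a).len.den, (I.arcs.get a).cap].getD i 0 := by
  unfold encode
  rw [List.getD_append_right _ _ _ _ (by simp; omega)]
  have h : 4 + I.terms.length + i + 5 * a.val - ([I.n, I.arcs.length, I.root.val,
      I.terms.length] ++ I.terms.map Fin.val).length = 5 * a.val + i := by
    simp; omega
  rw [h, getD_flatMap _ _ 5 (fun _ => rfl) a.isLt hi]
  rfl

theorem getD_encode_le (i : ℕ) : I.encode.getD i 0 ≤ bigProd I.encode := by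
  by_cases hi : i < I.encode.length
  · rw [List.getD_eq_getElem _ _ hi]
    exact le_bigProd (List.getElem_mem hi)
  · rw [List.getD_eq_default _ _ (not_lt.1 hi)]
    exact Nat.zero_le _

/-- Every vertex other than the root is the head of an arc. This matters because `n` is written in
binary: it makes `n` polynomial in the size of the input. -/
theorem n_le : I.n ≤ I.arcs.length + 1 := by
  have h : (Finset.univ : Finset (Fin I.n)) ⊆
      insert I.root (Finset.univ.image fun i : Fin I.arcs.length => (I.arcs.get i).head) := by
    intro v _
    rcases Relation.ReflTransGen.cases_tail (I.reach_root v) with h | ⟨u, -, a, ha, -, rfl⟩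
    · simp [h]
    · obtain ⟨i, rfl⟩ := List.get_of_mem ha
      exact Finset.mem_insert_of_mem (Finset.mem_image_of_mem _ (Finset.mem_univ i))
  have h1 := Finset.card_le_card h
  have h2 := Finset.card_insert_le I.root
    (Finset.univ.image fun i : Fin I.arcs.length => (I.arcs.get i).head)
  have h3 := Finset.card_image_le (s := (Finset.univ : Finset (Fin I.arcs.length)))
    (f := fun i => (I.arcs.get i).head)
  simp only [Finset.card_univ, Fintype.card_fin] at h1 h3
  omega

theorem n_pos : 0 < I.n := I.root.pos

/-! ### Position vectors as numbers in base `n` -/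

/-- The position of the token `x`, as a natural number. -/
def pos (f : Fin I.terms.length → Fin I.n) (x : ℕ) : ℕ :=
  if h : x < I.terms.length then f ⟨x, h⟩ else 0

/-- The code of the positions of the tokens. -/
def code (f : Fin I.terms.length → Fin I.n) : ℕ :=
  ∑ x ∈ Finset.range I.terms.length, I.pos f x * I.n ^ x

variable {I}

theorem pos_of_lt (f : Fin I.terms.length → Fin I.n) (j : Fin I.terms.length) :
    I.pos f j = f j := by
  simp [pos]

theorem pos_lt (f : Fin I.terms.length → Fin I.n) (x : ℕ) : I.pos f x < I.n := by
  unfold pos; split_ifs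
  exacts [Fin.isLt _, I.n_pos]

theorem sum_mul_pow_lt {n : ℕ} {g : ℕ → ℕ} (hg : ∀ x, g x < n) (k : ℕ) :
    ∑ x ∈ Finset.range k, g x * n ^ x < n ^ k := by
  induction k with
  | zero => simp
  | succ k ih =>
    rw [Finset.sum_range_succ, pow_succ]
    have : (g k + 1) * n ^ k ≤ n * n ^ k := Nat.mul_le_mul_right _ (hg k)
    nlinarith

theorem sum_mul_pow_div_mod {n : ℕ} {g : ℕ → ℕ} (hg : ∀ x, g x < n) {i k : ℕ} (hi : i < k) :
    (∑ x ∈ Finset.range k, g x * n ^ x) / n ^ i % n = g i := by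
  induction k generalizing i g with
  | zero => omega
  | succ k ih =>
    have hn : 0 < n := (Nat.zero_le _).trans_lt (hg 0)
    have h : ∑ x ∈ Finset.range (k + 1), g x * n ^ x =
        n * (∑ x ∈ Finset.range k, g (x + 1) * n ^ x) + g 0 := by
      rw [Finset.sum_range_succ', Finset.mul_sum, pow_zero, mul_one]
      congr 1
      exact Finset.sum_congr rfl fun x _ => by ring
    rw [h]
    cases i with
    | zero =>
      rw [pow_zero, Nat.div_one, Nat.mul_add_mod, Nat.mod_eq_of_lt (hg 0)]
    | succ i =>
      rw [pow_succ', ← Nat.div_div_eq_div_mul, Nat.mul_add_div hn, Nat.div_eq_of_lt (hg 0),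
        add_zero]
      exact ih (fun x => hg (x + 1)) (by omega)

theorem code_lt (f : Fin I.terms.length → Fin I.n) : I.code f < I.n ^ I.terms.length :=
  sum_mul_pow_lt (pos_lt f) _

theorem code_div_mod (f : Fin I.terms.length → Fin I.n) {x : ℕ} (hx : x < I.terms.length) :
    I.code f / I.n ^ x % I.n = I.pos f x :=
  sum_mul_pow_div_mod (pos_lt f) hx

theorem code_injective : Function.Injective I.code := by
  intro f g h
  funext j
  have h1 := code_div_mod f j.isLt
  rw [h, code_div_mod g j.isLt, pos_of_lt, pos_of_lt] at h1
  exact Fin.ext h1.symm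

/-- Makes a loop over all numbers below `n ^ K` a loop over all position vectors. -/
theorem exists_code_eq {c : ℕ} (hc : c < I.n ^ I.terms.length) : ∃ f, I.code f = c := by
  refine ⟨finFunctionFinEquiv.symm ⟨c, hc⟩, ?_⟩
  have := congrArg Fin.val (finFunctionFinEquiv.apply_symm_apply (⟨c, hc⟩ : Fin (I.n ^ _)))
  rw [finFunctionFinEquiv_apply] at this
  rw [code, Finset.sum_range]
  simpa only [pos_of_lt] using this

/-! ### Integer weights that encode arc sets -/

variable (I) in
/-- The weight of an arc: the sum of the weights of a set of arcs determines this set, and is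
essentially proportional to its length. -/
def arcWeight (a : Fin I.arcs.length) : ℕ :=
  (I.arcs.get a).len.num * (bigProd I.encode / (I.arcs.get a).len.den) + 2 ^ a.val

variable (I) in
/-- The total weight of a set of arcs. -/
def weight (S : Finset (Fin I.arcs.length)) : ℕ := ∑ a ∈ S, I.arcWeight a

theorem len_mem_encode (a : Fin I.arcs.length) : (I.arcs.get a).len.den ∈ I.encode := by
  have h := List.get_mem I.arcs a
  simp only [encode, List.mem_append, List.mem_flatMap]
  exact .inr ⟨_, h, by simp⟩

/-- `bigProd` is divisible by `2 ^ I.encode.length` times each denominator. Scaled lengths are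
therefore integers whose low bits vanish, and the powers `2 ^ a` occupy these bits without
interference. -/
theorem exists_weight_eq (S : Finset (Fin I.arcs.length)) :
    ∃ Y : ℕ, I.weight S = 2 ^ I.encode.length * Y + ∑ a ∈ S, 2 ^ a.val ∧
      (2 ^ I.encode.length * Y : ℚ≥0) = bigProd I.encode * I.length S := by
  have h (a : Fin I.arcs.length) : ∃ z : ℕ,
      bigProd I.encode = 2 ^ I.encode.length * (I.arcs.get a).len.den * z :=
    two_pow_mul_dvd_bigProd (len_mem_encode a) (NNRat.den_pos _)
  choose z hz using h
  refine ⟨∑ a ∈ S, (I.arcs.get a).len.num * z a, ?_, ?_⟩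
  · rw [weight, Finset.mul_sum, ← Finset.sum_add_distrib]
    refine Finset.sum_congr rfl fun a _ => ?_
    have hd : bigProd I.encode / (I.arcs.get a).len.den = 2 ^ I.encode.length * z a := by
      have h1 : bigProd I.encode = (I.arcs.get a).len.den * (2 ^ I.encode.length * z a) := by
        rw [hz a]; ring
      rw [h1, Nat.mul_div_cancel_left _ (NNRat.den_pos _)]
    rw [arcWeight, hd]
    ring
  · rw [Instance.length, Finset.mul_sum, Nat.cast_sum, Finset.mul_sum]
    refine Finset.sum_congr rfl fun a _ => ?_
    have h1 : (bigProd I.encode : ℚ≥0) =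
        2 ^ I.encode.length * (I.arcs.get a).len.den * z a := by
      rw [hz a]; push_cast; ring
    have h2 := NNRat.den_mul_eq_num (I.arcs.get a).len
    rw [h1, Nat.cast_mul, ← h2]
    ring

theorem sum_two_pow_lt (S : Finset (Fin I.arcs.length)) :
    ∑ a ∈ S, 2 ^ a.val < 2 ^ I.encode.length := by
  calc ∑ a ∈ S, 2 ^ a.val ≤ ∑ a : Fin I.arcs.length, 2 ^ a.val :=
        Finset.sum_le_sum_of_subset (Finset.subset_univ S)
    _ = ∑ a ∈ Finset.range I.arcs.length, 2 ^ a := (Finset.sum_range _).symm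
    _ < 2 ^ I.arcs.length := by
      have := Nat.geomSum_lt le_rfl (n := I.arcs.length) (s := Finset.range I.arcs.length)
        fun k hk => Finset.mem_range.1 hk
      exact this
    _ ≤ 2 ^ I.encode.length :=
      Nat.pow_le_pow_right (by norm_num) (by rw [length_encode]; omega)

/-- The low parts are less than `2 ^ I.encode.length`, so they can only break ties between equal
lengths. -/
theorem length_le_of_weight_le {S S' : Finset (Fin I.arcs.length)}
    (h : I.weight S ≤ I.weight S') : I.length S ≤ I.length S' := by
  obtain ⟨Y, h1, h2⟩ := exists_weight_eq S
  obtain ⟨Y', h1', h2'⟩ := exists_weight_eq S'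
  have hlt := sum_two_pow_lt S'
  have hY : Y ≤ Y' := by
    by_contra hY
    have : 2 ^ I.encode.length * (Y' + 1) ≤ 2 ^ I.encode.length * Y :=
      Nat.mul_le_mul_left _ (by omega)
    rw [mul_add] at this
    omega
  have hP : (0 : ℚ≥0) < bigProd I.encode := by exact_mod_cast bigProd_pos _
  refine le_of_mul_le_mul_left ?_ hP
  rw [← h2, ← h2']
  gcongr

theorem weight_div_mod (S : Finset (Fin I.arcs.length)) (i : Fin I.arcs.length) :
    I.weight S / 2 ^ i.val % 2 = if i ∈ S then 1 else 0 := by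
  obtain ⟨Y, h1, -⟩ := exists_weight_eq S
  have hi : i.val < I.encode.length := by have := i.isLt; rw [length_encode]; omega
  have hbit : (I.weight S).testBit i = decide (i ∈ S) := by
    rw [h1, Nat.testBit_two_pow_mul_add _ (sum_two_pow_lt S), if_pos hi]
    have hs : ∑ a ∈ S, 2 ^ a.val = ∑ a ∈ S.map Fin.valEmbedding, 2 ^ a := by
      rw [Finset.sum_map]; rfl
    have hm := Finset.toFinset_bitIndices_sum_two_pow (S.map Fin.valEmbedding)
    have : i.val ∈ S.map Fin.valEmbedding ↔ i ∈ S :=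
      Finset.mem_map' Fin.valEmbedding
    rw [← hm, List.mem_toFinset, Nat.mem_bitIndices] at this
    rw [hs, Bool.eq_iff_iff, this, decide_eq_true_iff]
  rw [← Nat.toNat_testBit, hbit]
  by_cases h : i ∈ S <;> simp [h]

theorem two_le_bigProd : 2 ≤ bigProd I.encode := by
  refine le_trans ?_ (two_pow_length_le_bigProd _)
  calc 2 = 2 ^ 1 := rfl
    _ ≤ _ := Nat.pow_le_pow_right (by norm_num) (by rw [length_encode]; omega)

theorem length_encode_lt : I.encode.length < bigProd I.encode :=
  (Nat.lt_two_pow_self).trans_le (two_pow_length_le_bigProd _)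

theorem two_pow_arcs_le {i : ℕ} (hi : i ≤ I.arcs.length) : 2 ^ (i + 1) ≤ bigProd I.encode :=
  (Nat.pow_le_pow_right (by norm_num) (by rw [length_encode]; omega)).trans
    (two_pow_length_le_bigProd _)

/-! ### Estimates that keep the cuts harmless -/

theorem pow_le_bound {k : ℕ} (hk : k ≤ I.terms.length + 6) :
    bigProd I.encode ^ k ≤ bigProd I.encode ^ (I.terms.length + 6) :=
  Nat.pow_le_pow_right (bigProd_pos _) hk

theorem le_bound {v : ℕ} (hv : v ≤ bigProd I.encode) :
    v ≤ bigProd I.encode ^ (I.terms.length + 6) :=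
  hv.trans (by simpa using pow_le_bound (I := I) (k := 1) (by omega))

theorem arcWeight_le (a : Fin I.arcs.length) : I.arcWeight a ≤ bigProd I.encode ^ 3 := by
  have h1 : (I.arcs.get a).len.num ≤ bigProd I.encode := by
    have := I.getD_encode_le (4 + I.terms.length + 2 + 5 * a)
    rwa [I.encode_arc a (by norm_num)] at this
  have h2 : bigProd I.encode / (I.arcs.get a).len.den ≤ bigProd I.encode := Nat.div_le_self _ _
  have h3 : 2 ^ a.val ≤ bigProd I.encode :=
    (Nat.pow_le_pow_right (by norm_num) (Nat.le_succ _)).trans (two_pow_arcs_le a.isLt.le)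
  have h4 := two_le_bigProd (I := I)
  have h5 := Nat.mul_le_mul h1 h2
  rw [arcWeight]
  nlinarith

/-- An arc weighs at most the cube of `bigProd`, and the number of arcs is less than `bigProd`, so a
fourth power suffices. The summand `1` is the offset that separates reached codes from unreached
ones. -/
theorem weight_lt_bound (S : Finset (Fin I.arcs.length)) :
    1 + I.weight S ≤ bigProd I.encode ^ (I.terms.length + 6) := by
  have h1 : I.weight S ≤ S.card * bigProd I.encode ^ 3 :=
    Finset.sum_le_card_nsmul _ _ _ fun a _ => arcWeight_le a
  have h2 : S.card ≤ I.arcs.length := by simpa using S.card_le_univ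
  have h3 : I.arcs.length < bigProd I.encode := by
    have := length_encode_lt (I := I)
    rw [length_encode] at this; omega
  have h4 : 1 ≤ bigProd I.encode ^ 3 := Nat.one_le_pow _ _ (bigProd_pos _)
  calc 1 + I.weight S ≤ bigProd I.encode ^ 3 + S.card * bigProd I.encode ^ 3 := add_le_add h4 h1
    _ = (S.card + 1) * bigProd I.encode ^ 3 := by ring
    _ ≤ bigProd I.encode * bigProd I.encode ^ 3 := Nat.mul_le_mul_right _ (by omega)
    _ = bigProd I.encode ^ 4 := by ring
    _ ≤ _ := pow_le_bound (by omega)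

theorem pow_n_le_bound {k : ℕ} (hk : k ≤ I.terms.length) :
    I.n ^ k ≤ bigProd I.encode ^ (I.terms.length + 6) :=
  (Nat.pow_le_pow_left (I.getD_encode_le 0) k).trans (pow_le_bound (by omega))

theorem le_loopBound {v : ℕ} (hv : v ≤ I.encode.length) :
    v ≤ I.encode.length ^ I.terms.length :=
  hv.trans (Nat.le_self_pow (by have := I.two_le_terms; omega) _)

theorem pow_n_le_loopBound : I.n ^ I.terms.length ≤ I.encode.length ^ I.terms.length :=
  Nat.pow_le_pow_left (by have := I.n_le; rw [length_encode]; omega) _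

end Instance
end CapSteiner

namespace CapSteiner
open LoopProg Instance

/-! ### The program: weights and levels -/

/-- The position in the input of the entry `i` of the arc `a`. -/
def arcIndex (K i a : ℕ) : ℕ := 4 + K + i + 5 * a

/-- The entry `i` of the arc in register `5`. -/
def arcE (K i : ℕ) : Expr := .get 0 (.add (.lit (4 + K + i)) (.mul (.lit 5) (.reg 5)))

theorem val_arcE (K i : ℕ) (s : State) :
    (arcE K i).val s = s.arr 0 (arcIndex K i (s.reg 5)) := rfl

/-- The number of vertices. -/
def numVertsE : Expr := .get 0 (.lit 0)

theorem val_numVertsE (s : State) : numVertsE.val s = s.arr 0 0 := rfl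

/-- The number of arcs. -/
def numArcsE : Expr := .get 0 (.lit 1)

/-- The state holds the instance and the bounds for numbers and loops. -/
structure Env (I : Instance) (s : State) : Prop where
  input : s.arr 0 = fun i => I.encode.getD i 0
  bound : s.reg 1 = bigProd I.encode ^ (I.terms.length + 6)
  rounds : s.reg 2 = I.encode.length ^ I.terms.length
  prod : s.reg 4 = bigProd I.encode

/-- The program does not change the instance and the bounds. -/
def keepsEnv (p : LoopProg) : Bool :=
  !p.setsReg 1 && !p.setsReg 2 && !p.setsReg 4 && !p.setsArr 0

namespace Env

variable {I : Instance} {s : State}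

theorem run (h : Env I s) {p : LoopProg} (hp : keepsEnv p = true) : Env I (p.run s) := by
  simp only [keepsEnv, Bool.and_eq_true, Bool.not_eq_true'] at hp
  exact ⟨(run_arr hp.2 s).trans h.input, (run_reg hp.1.1.1 s).trans h.bound,
    (run_reg hp.1.1.2 s).trans h.rounds, (run_reg hp.1.2 s).trans h.prod⟩

theorem setReg (h : Env I s) {x : ℕ} (h1 : x ≠ 1) (h2 : x ≠ 2) (h4 : x ≠ 4) (v : ℕ) :
    Env I (s.setReg x v) :=
  ⟨h.input, by simp [h1.symm, h.bound], by simp [h2.symm, h.rounds], by simp [h4.symm, h.prod]⟩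

theorem numVerts (h : Env I s) : s.arr 0 0 = I.n := by rw [h.input]; rfl

theorem numArcs (h : Env I s) : s.arr 0 1 = I.arcs.length := by rw [h.input]; rfl

theorem root (h : Env I s) : s.arr 0 2 = I.root := by rw [h.input]; rfl

theorem term (h : Env I s) (j : Fin I.terms.length) : s.arr 0 (4 + j) = I.terms.get j := by
  rw [h.input]; exact I.encode_term j

theorem tail (h : Env I s) (a : Fin I.arcs.length) :
    s.arr 0 (arcIndex I.terms.length 0 a) = (I.arcs.get a).tail := by
  rw [h.input]; exact I.encode_arc a (by norm_num)

theorem head (h : Env I s) (a : Fin I.arcs.length) :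
    s.arr 0 (arcIndex I.terms.length 1 a) = (I.arcs.get a).head := by
  rw [h.input]; exact I.encode_arc a (by norm_num)

theorem num (h : Env I s) (a : Fin I.arcs.length) :
    s.arr 0 (arcIndex I.terms.length 2 a) = (I.arcs.get a).len.num := by
  rw [h.input]; exact I.encode_arc a (by norm_num)

theorem den (h : Env I s) (a : Fin I.arcs.length) :
    s.arr 0 (arcIndex I.terms.length 3 a) = (I.arcs.get a).len.den := by
  rw [h.input]; exact I.encode_arc a (by norm_num)

theorem cap (h : Env I s) (a : Fin I.arcs.length) :
    s.arr 0 (arcIndex I.terms.length 4 a) = (I.arcs.get a).cap := by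
  rw [h.input]; exact I.encode_arc a (by norm_num)

theorem numVerts_le (h : Env I s) : I.n ≤ s.reg 2 :=
  h.rounds ▸ le_loopBound (by have := I.n_le; rw [length_encode]; omega)

theorem numArcs_le (h : Env I s) : I.arcs.length ≤ s.reg 2 :=
  h.rounds ▸ le_loopBound (by rw [length_encode]; omega)

theorem numTerms_le (h : Env I s) : I.terms.length ≤ s.reg 2 :=
  h.rounds ▸ le_loopBound (by rw [length_encode]; omega)

theorem le_bound (h : Env I s) {v : ℕ} (hv : v ≤ I.encode.length) : v ≤ s.reg 1 :=
  h.bound ▸ Instance.le_bound (hv.trans length_encode_lt.le)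

end Env

/-- Stores the weight of the arc in register `5`. -/
def weightBody (K : ℕ) : LoopProg :=
  .seq (.put 1 (.reg 5) (.add (.mul (arcE K 2) (.div (.reg 4) (arcE K 3))) (.reg 7)))
    (.set 7 (.add (.reg 7) (.reg 7)))

/-- Computes the weights of the arcs in array `1`. -/
def weightProg (K : ℕ) : LoopProg :=
  .seq (.set 7 (.lit 1)) (.loop 5 6 numArcsE (weightBody K))

theorem run_weightProg {I : Instance} {s : State} (h : Env I s) (a : Fin I.arcs.length) :
    ((weightProg I.terms.length).run s).arr 1 a = I.arcWeight a := by
  have h1 : 1 ≤ s.reg 1 := h.le_bound (by rw [length_encode]; omega)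
  have h' := h.setReg (x := 7) (by norm_num) (by norm_num) (by norm_num) (min 1 (s.reg 1))
  have key := run_loop (x := 5) (y := 6) (p := weightBody I.terms.length) rfl
    (s := s.setReg 7 (min 1 (s.reg 1))) (e := numArcsE) h'.numArcs h'.numArcs_le
    (fun i s => Env I s ∧ s.reg 7 = 2 ^ i ∧
      ∀ a : Fin I.arcs.length, a.val < i → s.arr 1 a = I.arcWeight a) ?_ ?_
  · exact key.2.2 a a.isLt
  · refine ⟨(h'.setReg ?_ ?_ ?_ _).setReg ?_ ?_ ?_ _, ?_, ?_⟩ <;> simp [h1]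
  · rintro i hi s h5 ⟨hE, h7, hw⟩
    refine ⟨(hE.run rfl).setReg (by norm_num) (by norm_num) (by norm_num) _, ?_, ?_⟩
    · have : 2 ^ i + 2 ^ i ≤ bigProd I.encode ^ (I.terms.length + 6) := by
        rw [← two_mul, ← pow_succ']
        exact Instance.le_bound (two_pow_arcs_le hi.le)
      simp [weightBody, LoopProg.run, Expr.val, h7, hE.bound, this]
      ring
    · intro a ha
      have h1 := hE.num a
      have h2 := hE.den a
      have h3 : I.arcWeight a ≤ bigProd I.encode ^ (I.terms.length + 6) :=
        (arcWeight_le a).trans (pow_le_bound (by omega))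
      by_cases hai : a.val = i
      · subst hai
        simp only [arcWeight] at h3
        simp [weightBody, LoopProg.run, val_arcE, Expr.val, h5, h7, h1, h2, hE.prod, hE.bound,
          arcWeight]
        simpa using h3
      · simp [weightBody, LoopProg.run, Expr.val, h5, hai, hw a (by omega)]

/-! ### Levels as lengths of longest walks -/

/-- Updates the level of the head of an arc. -/
def levelBody (K : ℕ) : LoopProg :=
  .ite (.sub (.add (.get 2 (arcE K 0)) (.lit 1)) (.get 2 (arcE K 1)))
    (.put 2 (arcE K 1) (.add (.get 2 (arcE K 0)) (.lit 1))) .skip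

/-- Computes the levels of the vertices in array `2`. -/
def levelProg (K : ℕ) : LoopProg :=
  .loop 8 9 numVertsE (.loop 5 6 numArcsE (levelBody K))

/-- There is a directed walk with `k` arcs that ends at `v`. -/
inductive WalkTo (I : Instance) : ℕ → Fin I.n → Prop
  | nil (v) : WalkTo I 0 v
  | cons {k} (a : Fin I.arcs.length) : WalkTo I k (I.arcs.get a).tail →
      WalkTo I (k + 1) (I.arcs.get a).head

/-- The set of vertices from which a nonempty walk leads to the current end gains at least the tail
of each further arc, which was not in it by acyclicity. Such a set has at most `n` elements. -/
theorem WalkTo.le {I : Instance} (hI : I.IsDAG) {k : ℕ} {v : Fin I.n} (h : WalkTo I k v) :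
    k ≤ I.n := by
  suffices k ≤ {u | Relation.TransGen
      (fun u w => ∃ a ∈ I.arcs, a.tail = u ∧ a.head = w) u v}.ncard by
    refine this.trans ((Set.ncard_le_ncard (Set.subset_univ _) (Set.toFinite _)).trans ?_)
    simp [Set.ncard_univ]
  induction h with
  | nil v => exact Nat.zero_le _
  | @cons k a _ ih =>
    have hr : ∃ b ∈ I.arcs, b.tail = (I.arcs.get a).tail ∧ b.head = (I.arcs.get a).head :=
      ⟨_, List.get_mem _ _, rfl, rfl⟩
    refine (Nat.succ_le_succ ih).trans ?_
    have hn : (I.arcs.get a).tail ∉ {u | Relation.TransGen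
        (fun u w => ∃ a ∈ I.arcs, a.tail = u ∧ a.head = w) u (I.arcs.get a).tail} := hI _
    rw [Nat.succ_eq_add_one, ← Set.ncard_insert_of_notMem hn (Set.toFinite _)]
    refine Set.ncard_le_ncard ?_ (Set.toFinite _)
    rintro u (rfl | hu)
    · exact .single hr
    · exact .tail hu hr

/-- Keeping each entry the length of an actual walk bounds it by `n`, so the cut does not interfere.
-/
theorem run_levelBody {I : Instance} (hI : I.IsDAG) {s : State} (h : Env I s)
    {a : Fin I.arcs.length} (h5 : s.reg 5 = a) (hw : ∀ v : Fin I.n, WalkTo I (s.arr 2 v) v) :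
    (∀ v : Fin I.n, WalkTo I (((levelBody I.terms.length).run s).arr 2 v) v ∧
      s.arr 2 v ≤ ((levelBody I.terms.length).run s).arr 2 v) ∧
    s.arr 2 (I.arcs.get a).tail + 1 ≤
      ((levelBody I.terms.length).run s).arr 2 (I.arcs.get a).head := by
  have h1 := h.tail a
  have h2 := h.head a
  have hc := WalkTo.cons a (hw (I.arcs.get a).tail)
  have hn : s.arr 2 (I.arcs.get a).tail + 1 ≤ s.reg 1 :=
    h.le_bound ((hc.le hI).trans (by have := I.n_le; rw [length_encode]; omega))
  simp only [levelBody, LoopProg.run, Expr.val, val_arcE, h5, h1, h2, min_eq_left hn]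
  split_ifs with hlt
  · exact ⟨fun v => ⟨hw v, le_rfl⟩, by simpa [Nat.sub_eq_zero_iff_le] using hlt⟩
  · refine ⟨fun v => ?_, by simp⟩
    by_cases hv : v = (I.arcs.get a).head
    · subst hv
      refine ⟨by simpa using hc, ?_⟩
      simp
      simp at hlt
      omega
    · have : v.val ≠ (I.arcs.get a).head.val := fun h => hv (Fin.ext h)
      simp only [State.setArr_arr_self, Function.update_of_ne this]
      exact ⟨hw v, le_rfl⟩

/-- After `k` rounds an entry is at least the length of every walk with at most `k` arcs that ends
there, and it is itself the length of a walk. No walk has more than `n` arcs, so `n` rounds yield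
longest walks. -/
theorem run_levelProg {I : Instance} (hI : I.IsDAG) {s : State} (h : Env I s)
    (h2 : s.arr 2 = fun _ => 0) :
    I.IsLevel fun v => ((levelProg I.terms.length).run s).arr 2 v := by
  have key := run_loop (x := 8) (y := 9) (e := numVertsE)
    (p := loop 5 6 numArcsE (levelBody I.terms.length)) rfl h.numVerts h.numVerts_le
    (fun k s => Env I s ∧ (∀ v : Fin I.n, WalkTo I (s.arr 2 v) v) ∧
      ∀ j ≤ k, ∀ v : Fin I.n, WalkTo I j v → j ≤ s.arr 2 v) ?_ ?_
  -- Appending the arc to a walk that realizes the level of the tail gives a longer walk to the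
  -- head.
  · intro a
    have hc := WalkTo.cons a (key.2.1 (I.arcs.get a).tail)
    exact key.2.2 _ (hc.le hI) _ hc
  · refine ⟨(h.setReg ?_ ?_ ?_ _).setReg ?_ ?_ ?_ _, ?_, ?_⟩ <;> try norm_num
    intro v
    simp only [h2]
    exact .nil v
  · rintro k - s - ⟨hE, hw, hk⟩
    obtain ⟨i1, i2, i3, i4⟩ := run_loop (x := 5) (y := 6) (e := numArcsE)
      (p := levelBody I.terms.length) rfl hE.numArcs hE.numArcs_le
      (fun i s => Env I s ∧ (∀ v : Fin I.n, WalkTo I (s.arr 2 v) v) ∧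
        (∀ j ≤ k, ∀ v : Fin I.n, WalkTo I j v → j ≤ s.arr 2 v) ∧
        ∀ a : Fin I.arcs.length, a.val < i → ∀ j ≤ k, WalkTo I j (I.arcs.get a).tail →
          j + 1 ≤ s.arr 2 (I.arcs.get a).head)
      ⟨(hE.setReg (by norm_num) (by norm_num) (by norm_num) _).setReg (by norm_num)
        (by norm_num) (by norm_num) _, hw, hk, fun a ha => absurd ha (Nat.not_lt_zero _)⟩
      (by
        rintro i hi s h5 ⟨hE, hw, hk, ha⟩
        obtain ⟨r1, r2⟩ := run_levelBody hI hE (a := ⟨i, hi⟩) h5 hw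
        refine ⟨(hE.run rfl).setReg (by norm_num) (by norm_num) (by norm_num) _,
          fun v => (r1 v).1, fun j hj v hv => (hk j hj v hv).trans (r1 v).2,
          fun a hai j hj hv => ?_⟩
        by_cases hai' : a.val = i
        · obtain rfl : a = ⟨i, hi⟩ := Fin.ext hai'
          exact (Nat.succ_le_succ (hk j hj _ hv)).trans r2
        · exact (ha a (by omega) j hj hv).trans (r1 _).2)
    refine ⟨i1.setReg (by norm_num) (by norm_num) (by norm_num) _, i2, fun j hj v hv => ?_⟩
    cases hv with
    | nil => exact Nat.zero_le _
    | cons a hv => exact i4 a a.isLt _ (by omega) hv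

end CapSteiner

namespace CapSteiner
open LoopProg Instance

/-! ### The program: initialization and moves -/

/-- Adds a digit to the codes of the start and of the goal. -/
def initBody : LoopProg :=
  .seq (.set 20 (.add (.reg 20) (.mul (.get 0 (.add (.lit 4) (.reg 12))) (.reg 21))))
    (.seq (.set 22 (.add (.reg 22) (.mul (.get 0 (.lit 2)) (.reg 21))))
      (.set 21 (.mul (.reg 21) numVertsE)))

/-- Computes the number of codes in register `21`, the code of the goal in register `22`, and the
initial distances in array `3`; there, a reached code is assigned one plus its distance,
and zero stands for an unreached code. -/
def initProg (K : ℕ) : LoopProg :=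
  .seq (.set 20 (.lit 0)) (.seq (.set 21 (.lit 1)) (.seq (.set 22 (.lit 0))
    (.seq (.loop 12 13 (.lit K) initBody) (.put 3 (.reg 20) (.lit 1)))))

theorem run_initProg {I : Instance} {s : State} (h : Env I s) (h3 : s.arr 3 = fun _ => 0) :
    ((initProg I.terms.length).run s).reg 21 = I.n ^ I.terms.length ∧
    ((initProg I.terms.length).run s).reg 22 = I.code (fun _ => I.root) ∧
    ((initProg I.terms.length).run s).arr 3 =
      Function.update (fun _ => 0) (I.code I.terms.get) 1 := by
  have h1 : 1 ≤ s.reg 1 := h.le_bound (by rw [length_encode]; omega)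
  have h' := ((h.setReg (x := 20) (by norm_num) (by norm_num) (by norm_num) 0).setReg (x := 21)
    (by norm_num) (by norm_num) (by norm_num) 1).setReg (x := 22)
    (by norm_num) (by norm_num) (by norm_num) 0
  have key := run_loop (x := 12) (y := 13) (e := .lit I.terms.length) (p := initBody) rfl
    (s := ((s.setReg 20 0).setReg 21 1).setReg 22 0) rfl h'.numTerms_le
    (fun i s => Env I s ∧ s.reg 20 = ∑ x ∈ Finset.range i, I.pos I.terms.get x * I.n ^ x ∧
      s.reg 21 = I.n ^ i ∧
      s.reg 22 = ∑ x ∈ Finset.range i, I.pos (fun _ => I.root) x * I.n ^ x ∧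
      s.arr 3 = fun _ => 0) ?_ ?_
  · have hrun : (initProg I.terms.length).run s = (LoopProg.put 3 (.reg 20) (.lit 1)).run
        ((loop 12 13 (.lit I.terms.length) initBody).run
          (((s.setReg 20 0).setReg 21 1).setReg 22 0)) := by
      simp [initProg, LoopProg.run, Expr.val, h1]
    obtain ⟨hE, k1, k2, k3, k4⟩ := key
    have hM : 1 ≤ ((loop 12 13 (.lit I.terms.length) initBody).run
        (((s.setReg 20 0).setReg 21 1).setReg 22 0)).reg 1 :=
      hE.le_bound (by rw [length_encode]; omega)
    rw [hrun]
    generalize (loop 12 13 (.lit I.terms.length) initBody).run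
        (((s.setReg 20 0).setReg 21 1).setReg 22 0) = s' at *
    refine ⟨k2, k3, ?_⟩
    simp only [LoopProg.run, Expr.val, State.setArr_arr_self, k1, k4, min_eq_left hM]
    rfl
  · refine ⟨(h'.setReg ?_ ?_ ?_ _).setReg ?_ ?_ ?_ _, ?_, ?_, ?_, ?_⟩ <;> simp [h3]
  · rintro i hi s h12 ⟨hE, k1, k2, k3, k4⟩
    have hb (f) := (sum_mul_pow_lt (pos_lt (I := I) f) (i + 1)).le.trans (pow_n_le_bound hi)
    have ht := hE.term ⟨i, hi⟩
    have hp1 := pos_of_lt I.terms.get ⟨i, hi⟩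
    have hp2 := pos_of_lt (fun _ => I.root) ⟨i, hi⟩
    have hb1 := hb I.terms.get
    have hb2 := hb (fun _ => I.root)
    have hn := pow_n_le_bound (I := I) (k := i + 1) hi
    simp only at ht hp1 hp2
    rw [Finset.sum_range_succ, hp1] at hb1
    rw [Finset.sum_range_succ, hp2] at hb2
    rw [pow_succ] at hn
    refine ⟨(hE.run rfl).setReg (by norm_num) (by norm_num) (by norm_num) _, ?_, ?_, ?_, ?_⟩
    · simp only [initBody, LoopProg.run, Expr.val, State.setReg_reg, State.setReg_arr]
      simp only [h12, ht, k1, k2, hE.bound, Finset.sum_range_succ, hp1]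
      simpa using hb1
    · simp only [initBody, LoopProg.run, Expr.val, val_numVertsE, State.setReg_reg,
        State.setReg_arr]
      simp only [hE.numVerts, k2, hE.bound, pow_succ I.n]
      simpa using hn
    · simp only [initBody, LoopProg.run, Expr.val, State.setReg_reg, State.setReg_arr]
      simp only [hE.root, k3, k2, hE.bound, Finset.sum_range_succ, hp2]
      simpa using hb2
    · exact k4

/-- The state holds the instance, the bounds, the weights and the levels. -/
structure Ctx (I : Instance) (lev : ℕ → ℕ) (s : State) : Prop extends Env I s where
  weights : ∀ a : Fin I.arcs.length, s.arr 1 a = I.arcWeight a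
  levels : s.arr 2 = lev
  codes : s.reg 21 = I.n ^ I.terms.length
  goal : s.reg 22 = I.code (fun _ => I.root)

/-- The program does not change the data of the instance. -/
def keepsCtx (p : LoopProg) : Bool :=
  keepsEnv p && !p.setsReg 21 && !p.setsReg 22 && !p.setsArr 1 && !p.setsArr 2

namespace Ctx

variable {I : Instance} {lev : ℕ → ℕ} {s : State}

theorem run (h : Ctx I lev s) {p : LoopProg} (hp : keepsCtx p = true) :
    Ctx I lev (p.run s) := by
  simp only [keepsCtx, Bool.and_eq_true, Bool.not_eq_true'] at hp
  obtain ⟨⟨⟨⟨h0, h1⟩, h2⟩, h3⟩, h4⟩ := hp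
  exact ⟨h.toEnv.run h0, fun a => (congrFun (run_arr h3 s) _).trans (h.weights a),
    (run_arr h4 s).trans h.levels, (run_reg h1 s).trans h.codes, (run_reg h2 s).trans h.goal⟩

theorem setReg (h : Ctx I lev s) {x : ℕ} (hx : 4 < x ∧ x < 21) (v : ℕ) :
    Ctx I lev (s.setReg x v) := by
  refine ⟨h.toEnv.setReg ?_ ?_ ?_ v, h.weights, h.levels, ?_, ?_⟩
  · omega
  · omega
  · omega
  · rw [State.setReg_reg, if_neg (by omega), h.codes]
  · rw [State.setReg_reg, if_neg (by omega), h.goal]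

end Ctx

/-- An expression that is nonzero if and only if the two values are equal. -/
def eqE (e₁ e₂ : Expr) : Expr := .sub (.lit 1) (.add (.sub e₁ e₂) (.sub e₂ e₁))

theorem val_eqE (e₁ e₂ : Expr) (s : State) :
    (eqE e₁ e₂).val s = if e₁.val s = e₂.val s then 1 else 0 := by
  simp only [eqE, Expr.val]; split_ifs <;> omega

/-- Moves one token. -/
def tokenBody (K : ℕ) : LoopProg :=
  .seq (.set 19 (.sub (.reg 14) (.mul (.div (.reg 14) numVertsE) numVertsE)))
  (.seq (.set 14 (.div (.reg 14) numVertsE))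
  (.seq (.set 18 (.add (.reg 18) (.sub (.get 2 (.reg 19)) (.get 2 (arcE K 1)))))
  (.seq (.set 17 (.add (.reg 17) (eqE (.reg 19) (arcE K 1))))
  (.seq (.set 16 (.add (.reg 16) (.mul (.add (.mul (eqE (.reg 19) (arcE K 1)) (arcE K 0))
    (.mul (.sub (.lit 1) (eqE (.reg 19) (arcE K 1))) (.reg 19))) (.reg 15))))
  (.set 15 (.mul (.reg 15) numVertsE))))))

/-- The state during the computation of a move, after `i` tokens. -/
structure TokenInv (I : Instance) (lev : ℕ → ℕ) (f : Fin I.terms.length → Fin I.n)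
    (a : Fin I.arcs.length) (d : ℕ → ℕ) (i : ℕ) (s : State) : Prop where
  ctx : Ctx I lev s
  arc : s.reg 5 = a
  code : s.reg 10 = I.code f
  dist : s.arr 3 = d
  rest : s.reg 14 = I.code f / I.n ^ i
  power : s.reg 15 = I.n ^ i
  new : s.reg 16 = ∑ x ∈ Finset.range i, I.pos (I.move f a) x * I.n ^ x
  count : s.reg 17 =
    ((Finset.range i).filter fun x => I.pos f x = (I.arcs.get a).head).card
  bad : s.reg 18 = 0 ↔ ∀ x < i, lev (I.pos f x) ≤ lev (I.arcs.get a).head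

theorem pos_move {I : Instance} (f : Fin I.terms.length → Fin I.n) (a : Fin I.arcs.length)
    {x : ℕ} (hx : x < I.terms.length) : I.pos (I.move f a) x =
      if I.pos f x = (I.arcs.get a).head then ((I.arcs.get a).tail : ℕ) else I.pos f x := by
  simp only [pos, hx, dif_pos, move, Fin.val_inj]
  split_ifs <;> rfl

/-- One round removes the lowest base `n` digit of the old code and appends the digit of the moved
token to the new one; the estimates show that all cuts are inactive. -/
theorem TokenInv.step {I : Instance} {lev : ℕ → ℕ} {f : Fin I.terms.length → Fin I.n}
    {a : Fin I.arcs.length} {d : ℕ → ℕ} {i : ℕ} {s : State} (hi : i < I.terms.length)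
    (h : TokenInv I lev f a d i s) :
    TokenInv I lev f a d (i + 1) (((tokenBody I.terms.length).run s).setReg 12 (i + 1)) := by
  obtain ⟨hC, h5, h10, hd, h14, h15, h16, h17, h18⟩ := h
  have hE := hC.toEnv
  -- There is no remainder operation, so the digit is computed as `q - q / n * n`.
  have hdigit : I.code f / I.n ^ i - I.code f / I.n ^ i / I.n * I.n = I.pos f i := by
    rw [← code_div_mod f hi, Nat.mod_eq_sub_div_mul]
  have hM : s.reg 1 = bigProd I.encode ^ (I.terms.length + 6) := hE.bound
  have h1M : 1 ≤ s.reg 1 := hE.le_bound (by rw [length_encode]; omega)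
  have hposM : I.pos f i ≤ s.reg 1 :=
    hE.le_bound ((pos_lt f i).le.trans (by have := I.n_le; rw [length_encode]; omega))
  have hrestM : I.code f / I.n ^ i / I.n ≤ s.reg 1 :=
    (Nat.div_le_self _ _).trans ((Nat.div_le_self _ _).trans
      ((code_lt f).le.trans (hM ▸ pow_n_le_bound le_rfl)))
  have hnewM := (sum_mul_pow_lt (pos_lt (I.move f a)) (i + 1)).le.trans
    (pow_n_le_bound (I := I) hi)
  rw [← hM, Finset.sum_range_succ, pos_move f a hi] at hnewM
  have hpowM := pow_n_le_bound (I := I) (k := i + 1) hi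
  rw [← hM, pow_succ] at hpowM
  have hcountM : ((Finset.range i).filter fun x => I.pos f x = (I.arcs.get a).head).card + 1 ≤
      s.reg 1 := by
    refine hE.le_bound ((Nat.succ_le_succ (Finset.card_filter_le _ _)).trans ?_)
    rw [Finset.card_range, length_encode]; omega
  refine ⟨(hC.run rfl).setReg (by norm_num) _, ?_, ?_, ?_, ?_, ?_, ?_, ?_, ?_⟩
  · rw [State.setReg_reg, if_neg (by norm_num), run_reg rfl, h5]
  · rw [State.setReg_reg, if_neg (by norm_num), run_reg rfl, h10]
  · rw [State.setReg_arr, run_arr rfl, hd]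
  · rw [pow_succ, ← Nat.div_div_eq_div_mul]
    simpa [tokenBody, LoopProg.run, Expr.val, val_numVertsE, hE.numVerts, h14] using hrestM
  · rw [pow_succ]
    simpa [tokenBody, LoopProg.run, Expr.val, val_numVertsE, hE.numVerts, h15] using hpowM
  · rw [Finset.sum_range_succ, pos_move f a hi]
    simp only [tokenBody, LoopProg.run, Expr.val, val_numVertsE, val_arcE, val_eqE,
      State.setReg_reg, State.setReg_arr]
    norm_num only [if_true, if_false]
    simp only [hE.numVerts, h14, h15, h16, hdigit, h5, hE.head a, hE.tail a, min_eq_left hposM]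
    split_ifs at hnewM ⊢ with hif
    · simpa using hnewM
    · simpa using hnewM
  · rw [Finset.range_add_one, Finset.filter_insert]
    simp only [tokenBody, LoopProg.run, Expr.val, val_numVertsE, val_arcE, val_eqE,
      State.setReg_reg, State.setReg_arr]
    norm_num only [if_true, if_false]
    simp only [hE.numVerts, h14, h17, hdigit, h5, hE.head a, min_eq_left hposM]
    split_ifs with hif
    · rw [Finset.card_insert_of_notMem (by simp), min_eq_left hcountM]
    · exact min_eq_left ((Nat.le_succ _).trans hcountM)
  -- Register `18` sums truncated level differences, so it is zero exactly when no token lies above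
  -- the head; here a cut would not matter, since `1 ≤ s.reg 1`.
  · rw [Nat.forall_lt_succ_right, ← h18]
    simp only [tokenBody, LoopProg.run, Expr.val, val_numVertsE, val_arcE, val_eqE,
      State.setReg_reg, State.setReg_arr]
    norm_num only [if_true, if_false]
    simp only [hE.numVerts, h14, hdigit, h5, hE.head a, min_eq_left hposM, hC.levels]
    omega

end CapSteiner

namespace CapSteiner
open LoopProg Instance

/-! ### The program: shortest sequences of moves -/

/-- Updates the distance of the positions after a move. -/
def updateProg (K : ℕ) : LoopProg :=
  .ite (.add (.reg 18) (.add (.sub (.reg 17) (arcE K 4)) (.sub (.lit 1) (.reg 17)))) .skip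
    (.ite (.add (.sub (.lit 1) (.get 3 (.reg 16)))
        (.sub (.get 3 (.reg 16)) (.add (.get 3 (.reg 10)) (.get 1 (.reg 5)))))
      (.put 3 (.reg 16) (.add (.get 3 (.reg 10)) (.get 1 (.reg 5)))) .skip)

/-- Tries to move along the arc in register `5` from the positions in register `10`. -/
def relaxProg (K : ℕ) : LoopProg :=
  .ite (.get 3 (.reg 10))
    (.seq (.set 14 (.reg 10)) (.seq (.set 15 (.lit 1)) (.seq (.set 16 (.lit 0))
      (.seq (.set 17 (.lit 0)) (.seq (.set 18 (.lit 0))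
        (.seq (.loop 12 13 (.lit K) (tokenBody K)) (updateProg K))))))) .skip

/-- Every finite distance is the weight of a sequence of moves. -/
def Sound (I : Instance) (lev d : ℕ → ℕ) : Prop :=
  ∀ f, d (I.code f) ≠ 0 →
    ∃ S, I.Traced (fun v => lev v) f S ∧ d (I.code f) = 1 + I.weight S

/-- The distance of `f` is finite and less than `v`. -/
def Reached (I : Instance) (d : ℕ → ℕ) (f : Fin I.terms.length → Fin I.n) (v : ℕ) : Prop :=
  d (I.code f) ≠ 0 ∧ d (I.code f) ≤ v

variable {I : Instance} {lev : ℕ → ℕ}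

/-- A sequence of moves never repeats an arc, so its total cost is the weight of its arc set. -/
theorem weight_insert (hlev : I.IsLevel fun v => lev v) {f : Fin I.terms.length → Fin I.n}
    {S : Finset (Fin I.arcs.length)} {a : Fin I.arcs.length}
    (hS : I.Traced (fun v => lev v) f S) (ha : I.Movable (fun v => lev v) f a) :
    I.weight (insert a S) = I.weight S + I.arcWeight a := by
  rw [Instance.weight, Finset.sum_insert ((hS.inv hlev).notMem ha), add_comm]
  rfl

/-- A sum of natural numbers vanishes only if all summands do: these test for maximum level, for the
capacity, and for the presence of a token at the head. -/
theorem TokenInv.movable_iff {f : Fin I.terms.length → Fin I.n} {a : Fin I.arcs.length}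
    {d : ℕ → ℕ} {s : State} (h : TokenInv I lev f a d I.terms.length s) :
    s.reg 18 + (s.reg 17 - (I.arcs.get a).cap + (1 - s.reg 17)) = 0 ↔
      I.Movable (fun v => lev v) f a := by
  have hcount : s.reg 17 =
      (Finset.univ.filter fun j => f j = (I.arcs.get a).head).card := by
    rw [h.count, Finset.card_filter, Finset.card_filter, Finset.sum_range]
    simp only [pos_of_lt, Fin.val_inj]
  have hbad : s.reg 18 = 0 ↔ ∀ j, lev (f j) ≤ lev (I.arcs.get a).head := by
    rw [h.bad]
    exact ⟨fun h j => by simpa only [pos_of_lt] using h j j.isLt,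
      fun h x hx => by simpa only [pos_of_lt] using pos_of_lt f ⟨x, hx⟩ ▸ h ⟨x, hx⟩⟩
  have hne : s.reg 17 ≠ 0 ↔ ∃ j, f j = (I.arcs.get a).head := by
    rw [hcount, Finset.card_ne_zero]
    simp [Finset.Nonempty]
  rw [Movable, ← hne, ← hbad, ← hcount]
  omega

theorem run_updateProg (hlev : I.IsLevel fun v => lev v) {f : Fin I.terms.length → Fin I.n}
    {a : Fin I.arcs.length} {d : ℕ → ℕ} {s : State} (hd : Sound I lev d)
    (hf : d (I.code f) ≠ 0) (h : TokenInv I lev f a d I.terms.length s) :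
    Sound I lev (((updateProg I.terms.length).run s).arr 3) ∧
    (∀ g v, Reached I d g v → Reached I (((updateProg I.terms.length).run s).arr 3) g v) ∧
    (I.Movable (fun v => lev v) f a → ∀ v, Reached I d f v →
      Reached I (((updateProg I.terms.length).run s).arr 3) (I.move f a) (v + I.arcWeight a)) := by
  have hnew : s.reg 16 = I.code (I.move f a) := h.new
  have hcap := h.ctx.cap a
  have hw := h.ctx.weights a
  have hmov := h.movable_iff
  simp only [updateProg, LoopProg.run, Expr.val, val_arcE, h.arc, hcap, h.dist, hnew, h.code, hw]
  obtain ⟨S, hS, hfS⟩ := hd f hf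
  split_ifs with h1 h2
  -- The move may be allowed, but the target already has a finite distance that is no larger.
  · exact ⟨h.dist ▸ hd, h.dist ▸ fun _ _ => id, fun hm v hv =>
      h.dist ▸ ⟨by omega, by have := hv.2; omega⟩⟩
  · have hm := hmov.1 h1
    have hw' := weight_insert hlev hS hm
    -- The candidate is one plus the weight of an actual arc set, so it is stored without being cut.
    have hbound : d (I.code f) + I.arcWeight a ≤ s.reg 1 := by
      rw [h.ctx.bound, hfS, add_assoc, ← hw']
      exact weight_lt_bound _
    simp only [State.setArr_arr_self, min_eq_left hbound, h.dist]
    refine ⟨fun g hg => ?_, fun g v hv => ?_, fun _ v hv => ?_⟩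
    · by_cases hgf : g = I.move f a
      · subst hgf
        exact ⟨_, hS.step hm, by rw [Function.update_self, hfS, hw', add_assoc]⟩
      · have hne : I.code g ≠ I.code (I.move f a) := fun h => hgf (code_injective h)
        rw [Function.update_of_ne hne] at hg ⊢
        exact hd g hg
    · by_cases hgf : g = I.move f a
      · subst hgf
        have := hv.1
        have := hv.2
        exact ⟨by rw [Function.update_self]; omega, by rw [Function.update_self]; omega⟩
      · have hne : I.code g ≠ I.code (I.move f a) := fun h => hgf (code_injective h)
        rwa [Reached, Function.update_of_ne hne]
    · have := hv.2
      exact ⟨by rw [Function.update_self]; omega, by rw [Function.update_self]; omega⟩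
  · exact ⟨h.dist ▸ hd, h.dist ▸ fun _ _ => id, fun hm => (h1 (hmov.2 hm)).elim⟩

theorem run_relaxProg (hlev : I.IsLevel fun v => lev v) {f : Fin I.terms.length → Fin I.n}
    {a : Fin I.arcs.length} {s : State} (hC : Ctx I lev s) (h5 : s.reg 5 = a)
    (h10 : s.reg 10 = I.code f) (hd : Sound I lev (s.arr 3)) :
    Sound I lev (((relaxProg I.terms.length).run s).arr 3) ∧
    (∀ g v, Reached I (s.arr 3) g v →
      Reached I (((relaxProg I.terms.length).run s).arr 3) g v) ∧
    (I.Movable (fun v => lev v) f a → ∀ v, Reached I (s.arr 3) f v →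
      Reached I (((relaxProg I.terms.length).run s).arr 3) (I.move f a) (v + I.arcWeight a)) := by
  by_cases hf : s.arr 3 (I.code f) = 0
  · have : (relaxProg I.terms.length).run s = s := by
      simp [relaxProg, LoopProg.run, Expr.val, h10, hf]
    rw [this]
    exact ⟨hd, fun _ _ => id, fun _ v hv => (hv.1 hf).elim⟩
  · have h1 : 1 ≤ s.reg 1 := hC.le_bound (by rw [length_encode]; omega)
    have h2 : I.code f ≤ s.reg 1 := hC.bound ▸ (code_lt f).le.trans (pow_n_le_bound le_rfl)
    have hrun : (relaxProg I.terms.length).run s = (updateProg I.terms.length).run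
        ((loop 12 13 (.lit I.terms.length) (tokenBody I.terms.length)).run
          (((((s.setReg 14 (I.code f)).setReg 15 1).setReg 16 0).setReg 17 0).setReg 18 0)) := by
      rw [relaxProg, LoopProg.run]
      simp only [Expr.val, h10, hf, if_false]
      simp [LoopProg.run, Expr.val, h1, h2, h10]
    have hC' := ((((hC.setReg (x := 14) (by norm_num) (I.code f)).setReg (x := 15) (by norm_num)
      1).setReg (x := 16) (by norm_num) 0).setReg (x := 17) (by norm_num) 0).setReg (x := 18)
      (by norm_num) 0
    rw [hrun]
    refine run_updateProg hlev hd hf ?_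
    refine run_loop (e := .lit I.terms.length) (k := I.terms.length) rfl rfl hC'.numTerms_le
      (fun i s' => TokenInv I lev f a (s.arr 3) i s') ?_
      fun i hi s _ h => h.step hi
    exact ⟨(hC'.setReg (by norm_num) _).setReg (by norm_num) _, by simp [h5], by simp [h10],
      rfl, by simp, by simp, by simp, by simp, by simp⟩

/-! ### Bellman-Ford rounds on position vectors -/

/-- The distances during round `k`, after all moves from codes less than `c`, and
from the code `c` along arcs less than `i`. -/
structure Round (I : Instance) (lev : ℕ → ℕ) (k c i : ℕ) (d : ℕ → ℕ) : Prop where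
  sound : Sound I lev d
  complete : ∀ f S, I.Traced (fun v => lev v) f S → S.card ≤ k → Reached I d f (1 + I.weight S)
  moved : ∀ f S a, I.Traced (fun v => lev v) f S → S.card ≤ k → I.Movable (fun v => lev v) f a →
    (I.code f < c ∨ I.code f = c ∧ a.val < i) →
      Reached I d (I.move f a) (1 + I.weight S + I.arcWeight a)

theorem Round.init : Round I lev 0 0 0 (Function.update (fun _ => 0) (I.code I.terms.get) 1) := by
  refine ⟨fun f hf => ?_, fun f S h hS => ?_, fun f S a _ _ _ h => by omega⟩
  · by_cases h : I.code f = I.code I.terms.get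
    · obtain rfl := code_injective h
      exact ⟨∅, .start, by simp [Instance.weight]⟩
    · rw [Function.update_of_ne h] at hf
      exact (hf rfl).elim
  · cases h with
    | start => exact ⟨by simp, by simp⟩
    | step _ _ => simp at hS

theorem Round.next_code {k c : ℕ} {d : ℕ → ℕ} (h : Round I lev k c I.arcs.length d) :
    Round I lev k (c + 1) 0 d :=
  ⟨h.sound, h.complete, fun f S a h1 h2 h3 h4 => h.moved f S a h1 h2 h3 (by omega)⟩

/-- The number of moves equals the number of arcs used. A sequence of `k + 1` moves is one of `k`
moves followed by a move that this round has tried. -/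
theorem Round.next_round (hlev : I.IsLevel fun v => lev v) {k : ℕ} {d : ℕ → ℕ}
    (h : Round I lev k (I.n ^ I.terms.length) 0 d) : Round I lev (k + 1) 0 0 d := by
  refine ⟨h.sound, fun f S hT hS => ?_, fun f S a _ _ _ h => by omega⟩
  cases hT with
  | start => exact h.complete _ _ .start (Nat.zero_le _)
  | @step f S a hT ha =>
    rw [Finset.card_insert_of_notMem ((hT.inv hlev).notMem ha)] at hS
    rw [weight_insert hlev hT ha, ← add_assoc]
    exact h.moved f S a hT (by omega) ha (.inl (code_lt f))

/-- Computes the distances in array `3`. -/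
def distProg (K : ℕ) : LoopProg :=
  .loop 8 9 numArcsE (.loop 10 11 (.reg 21) (.loop 5 6 numArcsE (relaxProg K)))

theorem run_arcLoop (hlev : I.IsLevel fun v => lev v) {k : ℕ}
    {f : Fin I.terms.length → Fin I.n} {s : State} (hC : Ctx I lev s)
    (h10 : s.reg 10 = I.code f) (hR : Round I lev k (I.code f) 0 (s.arr 3)) :
    Round I lev k (I.code f + 1) 0
      (((loop 5 6 numArcsE (relaxProg I.terms.length)).run s).arr 3) := by
  refine Round.next_code (run_loop (e := numArcsE) rfl hC.numArcs hC.numArcs_le (fun i s =>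
    Ctx I lev s ∧ s.reg 10 = I.code f ∧ Round I lev k (I.code f) i (s.arr 3)) ?_ ?_).2.2
  · exact ⟨(hC.setReg (by norm_num) _).setReg (by norm_num) _, by simp [h10], hR⟩
  · rintro i hi s h5 ⟨hC, h10, hR⟩
    obtain ⟨r1, r2, r3⟩ := run_relaxProg hlev (a := ⟨i, hi⟩) hC h5 h10 hR.sound
    refine ⟨(hC.run rfl).setReg (by norm_num) _, ?_, r1,
      fun g S hT hS => r2 _ _ (hR.complete g S hT hS), fun g S a hT hS ha hg => ?_⟩
    · rw [State.setReg_reg, if_neg (by norm_num), run_reg rfl, h10]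
    · by_cases hlast : I.code g = I.code f ∧ a.val = i
      · obtain rfl := code_injective hlast.1
        obtain rfl : a = ⟨i, hi⟩ := Fin.ext hlast.2
        exact r3 ha _ (hR.complete g S hT hS)
      · exact r2 _ _ (hR.moved g S a hT hS ha (by omega))

theorem run_codeLoop (hlev : I.IsLevel fun v => lev v) {k : ℕ} {s : State} (hC : Ctx I lev s)
    (hR : Round I lev k 0 0 (s.arr 3)) :
    Round I lev (k + 1) 0 0
      (((loop 10 11 (.reg 21) (loop 5 6 numArcsE (relaxProg I.terms.length))).run s).arr 3) := by
  refine Round.next_round hlev (run_loop (e := .reg 21) rfl hC.codes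
    (hC.rounds ▸ pow_n_le_loopBound) (fun c s =>
      Ctx I lev s ∧ Round I lev k c 0 (s.arr 3)) ?_ ?_).2
  · exact ⟨(hC.setReg (by norm_num) _).setReg (by norm_num) _, hR⟩
  · rintro c hc s h10 ⟨hC, hR⟩
    obtain ⟨f, rfl⟩ := exists_code_eq hc
    exact ⟨(hC.run rfl).setReg (by norm_num) _, run_arcLoop hlev hC h10 hR⟩

theorem run_distProg (hlev : I.IsLevel fun v => lev v) {s : State} (hC : Ctx I lev s)
    (hs : s.arr 3 = Function.update (fun _ => 0) (I.code I.terms.get) 1) :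
    Round I lev I.arcs.length 0 0 (((distProg I.terms.length).run s).arr 3) := by
  refine (run_loop (e := numArcsE) rfl hC.numArcs hC.numArcs_le (fun k s =>
    Ctx I lev s ∧ Round I lev k 0 0 (s.arr 3)) ?_ ?_).2
  · exact ⟨(hC.setReg (by norm_num) _).setReg (by norm_num) _, by
      simp only [State.setReg_arr, hs]; exact .init⟩
  · rintro k - s - ⟨hC, hR⟩
    exact ⟨(hC.run rfl).setReg (by norm_num) _, run_codeLoop hlev hC hR⟩

/-- A traced arc set has at most as many arcs as the instance, so every sequence of moves is
covered. A competitor is first trimmed to a traced subset, which is no longer because lengths are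
nonnegative. -/
theorem isOptimal_of_round (hlev : I.IsLevel fun v => lev v) {d : ℕ → ℕ}
    (h : Round I lev I.arcs.length 0 0 d) :
    (d (I.code fun _ => I.root) = 0 ∧ ∀ S, ¬ I.IsFeasible S) ∨
      ∃ S, I.IsOptimal S ∧ d (I.code fun _ => I.root) = 1 + I.weight S := by
  have hcard (S : Finset (Fin I.arcs.length)) : S.card ≤ I.arcs.length := by
    simpa using S.card_le_univ
  by_cases hd : d (I.code fun _ => I.root) = 0
  · refine .inl ⟨hd, fun S hS => ?_⟩
    obtain ⟨S', -, hS'⟩ := hS.exists_traced hlev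
    exact (h.complete _ _ hS' (hcard S')).1 hd
  · obtain ⟨S, hS, hw⟩ := h.sound _ hd
    refine .inr ⟨S, ⟨hS.isFeasible hlev, fun S' hS' => ?_⟩, hw⟩
    obtain ⟨S'', hsub, hS''⟩ := hS'.exists_traced hlev
    have := (h.complete _ _ hS'' (hcard S'')).2
    refine (length_le_of_weight_le (S' := S'') (by omega)).trans ?_
    exact Finset.sum_le_sum_of_subset hsub

/-! ### Reading the arc set off the optimal weight -/

/-- Writes the answer. -/
def outputProg : LoopProg :=
  .ite (.get 3 (.reg 22))
    (.seq (.set 7 (.sub (.get 3 (.reg 22)) (.lit 1)))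
      -- The output overwrites the input, including the number of arcs in cell `1`; this number
      -- survives in register `6`, which was set on entry to the loop.
      (.seq (.loop 5 6 numArcsE
        (.seq (.put 0 (.add (.reg 5) (.lit 1))
            (.sub (.reg 7) (.mul (.div (.reg 7) (.lit 2)) (.lit 2))))
          (.set 7 (.div (.reg 7) (.lit 2)))))
      (.seq (.put 0 (.lit 0) (.lit 1)) (.set 0 (.add (.reg 6) (.lit 1))))))
    (.seq (.put 0 (.lit 0) (.lit 0)) (.set 0 (.lit 1)))

theorem output_eq {s : State} {m : ℕ} (h0 : s.reg 0 = m + 1) (g : Fin m → ℕ)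
    (h1 : s.arr 0 0 = 1) (hg : ∀ i, s.arr 0 (i.val + 1) = g i) :
    s.output = 1 :: List.ofFn g := by
  rw [State.output, h0, List.range_succ_eq_map, List.map_cons, h1, List.map_map]
  congr 1
  refine List.ext_getElem (by simp) fun i h2 h3 => ?_
  have := hg ⟨i, by simpa using h2⟩
  simpa using this

theorem run_outputProg {s : State} (hC : Ctx I lev s)
    (h : (s.arr 3 (I.code fun _ => I.root) = 0 ∧ ∀ S, ¬ I.IsFeasible S) ∨
      ∃ S, I.IsOptimal S ∧ s.arr 3 (I.code fun _ => I.root) = 1 + I.weight S) :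
    I.CorrectAnswer (outputProg.run s).output := by
  have h1 : 1 ≤ s.reg 1 := hC.le_bound (by rw [length_encode]; omega)
  rcases h with ⟨h0, hS⟩ | ⟨S, hS, hw⟩
  · refine .inl ⟨hS, ?_⟩
    simp [outputProg, LoopProg.run, Expr.val, hC.goal, h0, State.output, h1]
  · refine .inr ⟨S, hS, ?_⟩
    have hM := hC.bound
    have hwM : I.weight S ≤ s.reg 1 := hM ▸ (Nat.le_add_left _ _).trans (weight_lt_bound S)
    have hC' := hC.setReg (x := 7) (by norm_num) (I.weight S)
    obtain ⟨k1, k2, k3, k4⟩ := run_loop (x := 5) (y := 6) (e := numArcsE)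
      (p := .seq (.put 0 (.add (.reg 5) (.lit 1))
            (.sub (.reg 7) (.mul (.div (.reg 7) (.lit 2)) (.lit 2))))
          (.set 7 (.div (.reg 7) (.lit 2)))) rfl (s := s.setReg 7 (I.weight S))
      hC'.numArcs hC'.numArcs_le
      -- The invariant cannot include `Ctx`, because the input array is being overwritten.
      (fun i s => s.reg 1 = bigProd I.encode ^ (I.terms.length + 6) ∧
        s.reg 6 = I.arcs.length ∧ s.reg 7 = I.weight S / 2 ^ i ∧
        ∀ a : Fin I.arcs.length, a.val < i → s.arr 0 (a + 1) = if a ∈ S then 1 else 0)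
      (by simp [hC.bound]) (by
        rintro i hi s' h5 ⟨k1, k2, k3, k4⟩
        have hle : I.weight S / 2 ^ i / 2 ≤ s'.reg 1 := by
          rw [k1, ← hM]
          exact (Nat.div_le_self _ _).trans ((Nat.div_le_self _ _).trans hwM)
        refine ⟨?_, ?_, ?_, fun a ha => ?_⟩
        · simp only [LoopProg.run]; simpa using k1
        · simp only [LoopProg.run]; simpa using k2
        · rw [pow_succ, ← Nat.div_div_eq_div_mul]
          simpa [LoopProg.run, Expr.val, k3] using hle
        · by_cases hai : a.val = i
          · subst hai
            have hb : I.weight S / 2 ^ a.val - I.weight S / 2 ^ a.val / 2 * 2 =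
                if a ∈ S then 1 else 0 := by
              rw [← weight_div_mod S a, Nat.mod_eq_sub_div_mul]
            have h1' : 1 ≤ s'.reg 1 := by omega
            simp only [LoopProg.run, Expr.val, h5, k3, hb, State.setReg_arr,
              State.setArr_arr_self, Function.update_self]
            split_ifs <;> omega
          · simp only [LoopProg.run, Expr.val, h5, State.setReg_arr, State.setArr_arr_self]
            rw [Function.update_of_ne (by omega)]
            exact k4 a (by omega))
    have hrun : outputProg.run s = (LoopProg.seq (.put 0 (.lit 0) (.lit 1))
        (.set 0 (.add (.reg 6) (.lit 1)))).run ((loop 5 6 numArcsE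
          (.seq (.put 0 (.add (.reg 5) (.lit 1))
            (.sub (.reg 7) (.mul (.div (.reg 7) (.lit 2)) (.lit 2))))
          (.set 7 (.div (.reg 7) (.lit 2))))).run (s.setReg 7 (I.weight S))) := by
      refine (if_neg ?_).trans ?_
      · simp only [Expr.val, hC.goal, hw]; omega
      simp only [LoopProg.run, Expr.val, hC.goal, hw, Nat.add_sub_cancel_left, min_eq_left hwM]
    rw [hrun]
    generalize (loop 5 6 numArcsE _).run (s.setReg 7 (I.weight S)) = s' at *
    have hm : I.arcs.length + 1 ≤ s'.reg 1 := by
      rw [k1, ← hM]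
      exact hC.le_bound (by rw [length_encode]; omega)
    have h1' : 1 ≤ s'.reg 1 := by omega
    refine output_eq ?_ _ ?_ fun a => ?_
    · simp [LoopProg.run, Expr.val, k2, hm]
    · simp [LoopProg.run, Expr.val, h1']
    · simpa [LoopProg.run, Expr.val] using k4 a a.isLt

/-! ### Assembly -/

/-- The whole program after the prelude. -/
def steinerProg (K : ℕ) : LoopProg :=
  .seq (weightProg K) (.seq (levelProg K) (.seq (initProg K) (.seq (distProg K) outputProg)))

theorem env_prepared (I : Instance) : Env I (prepared I.terms.length I.encode) := by
  refine ⟨?_, ?_, ?_, ?_⟩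
  · funext i; simp [prepared, preludeState, State.ofInput]
  · simp [prepared]
  · simp [prepared]
  · simp [prepared, preludeState]

theorem run_steinerProg (hI : I.IsDAG) :
    I.CorrectAnswer
      ((steinerProg I.terms.length).run (prepared I.terms.length I.encode)).output := by
  set s₀ := prepared I.terms.length I.encode with hs₀
  have harr (a : ℕ) (ha : a ≠ 0) : s₀.arr a = fun _ => 0 := by
    funext i; simp [hs₀, prepared, preludeState, State.ofInput, ha]
  have hE₀ : Env I s₀ := env_prepared I
  set s₁ := (weightProg I.terms.length).run s₀ with hs₁
  have hE₁ : Env I s₁ := hE₀.run rfl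
  have hw₁ := run_weightProg hE₀
  set s₂ := (levelProg I.terms.length).run s₁ with hs₂
  have hE₂ : Env I s₂ := hE₁.run rfl
  have hlev : I.IsLevel fun v => s₂.arr 2 v :=
    run_levelProg hI hE₁ ((run_arr rfl s₀).trans (harr 2 (by norm_num)))
  set s₃ := (initProg I.terms.length).run s₂ with hs₃
  have h3 : s₂.arr 3 = fun _ => 0 :=
    (run_arr rfl s₁).trans ((run_arr rfl s₀).trans (harr 3 (by norm_num)))
  obtain ⟨h21, h22, hd⟩ := run_initProg hE₂ h3
  have hC₃ : Ctx I (s₂.arr 2) s₃ := by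
    refine ⟨hE₂.run rfl, fun a => ?_, run_arr rfl s₂, h21, h22⟩
    rw [← hw₁ a, hs₃, run_arr rfl, hs₂, run_arr rfl]
  exact run_outputProg (hC₃.run (p := distProg I.terms.length) rfl)
    (isOptimal_of_round hlev (run_distProg hlev hC₃ hd))

end CapSteiner

theorem mainTheorem10 (K : ℕ) (hK : 2 ≤ K) :
    CapSteiner.SolvableInPolyTime CapSteiner.Instance.encode
      (fun I => I.IsDAG ∧ I.terms.length = K) CapSteiner.Instance.CorrectAnswer := by
  -- Well-formedness is checked by evaluation, although `K` is a variable: `K` enters the program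
  -- only through literals, which this check ignores.
  obtain ⟨b, hb⟩ := CapSteiner.exists_polynomial_exec K (p := CapSteiner.steinerProg K) rfl
  refine ⟨.seq (CapSteiner.prelude K) (CapSteiner.steinerProg K).compile, b, ?_⟩
  rintro I ⟨hI, rfl⟩
  obtain ⟨t, h1, h2⟩ := hb I.encode
  exact ⟨_, t, h1, h2, CapSteiner.run_steinerProg hI⟩
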